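/- Let $k\ge 1$ be an integer and let $f:[0,1]\to\mathbb{R}$ have an absolutely continuous $(k-1)$-st derivative $f^{(k-1)}$ on $[0,1]$ and a $k$-th derivative $f^{(k)}$ of bounded variation (that is, $f^{(k)}$, which exists almost everywhere, agrees almost everywhere with a function of bounded variation on $[0,1]$). Let $\alpha,\beta>-1$, $\nu\ge 0$ and $\omega\ge 0$ be fixed real numbers, let $J_\nu$ be the Bessel function of the first kind of order $\nu$, and put $$I[f]=\int_0^1 x^\alpha(1-x)^\beta f(x)J_\nu(\omega x)\,dx .$$ For $N\ge 1$ let $P_N$ be the polynomial of degree at most $N$ that interpolates $f$ at the $N+1$ Clenshaw–Curtis points $c_i=\tfrac12+\tfrac12\cos(i\pi/N)$, $i=0,\dots,N$, and let $$Q_N[f]=\int_0^1 x^\alpha(1-x)^\beta P_N(x)J_\nu(\omega x)\,dx$$ be the $(N+1)$-point Clenshaw–Curtis–Filon rule. Then there is a constant $C$, independent of $N$, such that for all $N\ge k+1$ $$\bigl|I[f]-Q_N[f]\bigr|\le\begin{cases} C\,N^{-2\min\{\alpha,\beta\}-k-2}, & -1<\min\{\alpha,\beta\}<-\tfrac12,\\[2pt]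 C\,N^{-k-1}, & \min\{\alpha,\beta\}\ge-\tfrac12.\end{cases}$$ -/

import Mathlib

noncomputable section

namespace CCF

/-- The Bessel function of the first kind of order `ν ≥ 0` at a real point `x ≥ 0`, by its
(everywhere convergent) power series
`J_ν(x) = ∑ (-1)^m / (m! Γ(m + ν + 1)) (x / 2)^(2m + ν)`. -/
def besselJ (ν x : ℝ) : ℝ :=
  ∑' m : ℕ, (-1 : ℝ) ^ m / ((m.factorial : ℝ) * Real.Gamma ((m : ℝ) + ν + 1)) *
    (x / 2) ^ (2 * (m : ℝ) + ν)

/-- The oscillatory Bessel transform `I[f] = ∫₀¹ x^α (1-x)^β f(x) J_ν(ωx) dx`. -/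
def besselTransform (α β ν ω : ℝ) (f : ℝ → ℝ) : ℝ :=
  ∫ x in (0 : ℝ)..1, x ^ α * (1 - x) ^ β * f x * besselJ ν (ω * x)

/-- The Clenshaw–Curtis points `c_i = 1/2 + cos(iπ/N)/2`, `i = 0, …, N`, on `[0, 1]`. -/
def node (N i : ℕ) : ℝ :=
  1 / 2 + 1 / 2 * Real.cos ((i : ℝ) * Real.pi / (N : ℝ))

/-- The polynomial `P_N` of degree at most `N` that interpolates `f` at the `N + 1`
Clenshaw–Curtis points. -/
def interpolant (N : ℕ) (f : ℝ → ℝ) : Polynomial ℝ :=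
  Lagrange.interpolate (Finset.range (N + 1)) (node N) (fun i => f (node N i))

/-- The `(N+1)`-point Clenshaw–Curtis–Filon rule
`Q[f] = ∫₀¹ x^α (1-x)^β P_N(x) J_ν(ωx) dx`. -/
def filonRule (α β ν ω : ℝ) (N : ℕ) (f : ℝ → ℝ) : ℝ :=
  besselTransform α β ν ω (fun x => (interpolant N f).eval x)

/-- For `k ≥ 1`: the derivatives of `f` on `[0, 1]` (one-sided at the end points) up to order
`k - 1` exist, `f^(k-1)` is absolutely continuous on `[0, 1]`, and the `k`-th derivative, which
then exists almost everywhere, is of bounded variation, i.e. agrees almost everywhere with a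
function of bounded variation on `[0, 1]`. -/
structure HasBVDeriv (k : ℕ) (f : ℝ → ℝ) : Prop where
  contDiffOn : ContDiffOn ℝ ((k - 1 : ℕ) : ℕ∞) f (Set.Icc 0 1)
  absolutelyContinuous :
    AbsolutelyContinuousOnInterval (iteratedDerivWithin (k - 1) f (Set.Icc 0 1)) 0 1
  boundedVariation : ∃ g : ℝ → ℝ, BoundedVariationOn g (Set.Icc 0 1) ∧
    ∀ᵐ x ∂(MeasureTheory.volume.restrict (Set.Icc (0 : ℝ) 1)),
      HasDerivWithinAt (iteratedDerivWithin (k - 1) f (Set.Icc 0 1)) (g x) (Set.Icc 0 1) x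

end CCF

end

/-! Under x = cos²(t/2), f becomes an even 2π-periodic function of t with cosine coefficients a_n,
and both integrals are taken against one weight W with cosine coefficients w_n. At the nodes cos(nt)
and cos(ρt) agree whenever n ≡ ρ mod 2N, so interpolation replaces each frequency n by its residue
ρ(n) in [-N, N). The error is therefore π⁻¹ ∑ a_n (w_n - w_ρ(n)) (`hasSum_interpolation_error`).

Two decay rates enter. First, a_n = O(|n|^(-k-1)): bounded variation gives one power and each of the
k integrations one more (`HasBVDeriv.coeffDecay`). Second, W is cos(t/2)^(2(α+ν)+1) sin(t/2)^(2β+1)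
times a smooth factor, so w_n = O(n^(-1-μ)), with μ = 2 min(α,β) + 1 if this is negative
(`jacobiWeight_decay`) and with some μ > 0 if both exponents are nonnegative
(`jacobiWeight_decay_of_nonneg`).

Writing n = 2Nl + ρ, the block l = 0 cancels and the others satisfy |a_n| ≤ C N^(-k-1) l^(-2). The
error is thus at most a constant times N^(-k-1) (N · N^(-1-μ) + ∑ |w_ρ|), the sum being over one
period of residues. The bracket is O(N^(-μ)) in the first case and O(1) in the second
(`exists_interpolation_error_le`). -/

namespace CCF

open MeasureTheory Set intervalIntegral

/-! ### Decay of the Chebyshev coefficients. -/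

/-- The unnormalised `n`-th Chebyshev coefficient of `f` on `[0, 1]`. -/
noncomputable def cosCoeff (f : ℝ → ℝ) (n : ℤ) : ℝ :=
  ∫ t in (0 : ℝ)..Real.pi, f (1 / 2 + 1 / 2 * Real.cos t) * Real.cos (n * t)

lemma cosCoeff_neg (f : ℝ → ℝ) (n : ℤ) : cosCoeff f (-n) = cosCoeff f n := by
  simp [cosCoeff]

lemma half_cos_mem (t : ℝ) : 1 / 2 + 1 / 2 * Real.cos t ∈ Icc (0 : ℝ) 1 :=
  ⟨by linarith [Real.neg_one_le_cos t], by linarith [Real.cos_le_one t]⟩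

lemma hasDerivAt_half_cos (t : ℝ) :
    HasDerivAt (fun t => 1 / 2 + 1 / 2 * Real.cos t) (-(1 / 2 * Real.sin t)) t := by
  simpa only [mul_neg] using ((Real.hasDerivAt_cos t).const_mul (1 / 2)).const_add (1 / 2)

/-- Integration by parts for a primitive of an integrable function. -/
lemma integral_primitive_mul_deriv {u v v' F : ℝ → ℝ} {a b c : ℝ} (hab : a ≤ b)
    (hu : IntervalIntegrable u volume a b) (hF : ∀ x ∈ Icc a b, F x = c + ∫ t in a..x, u t)
    (hv : ∀ x, HasDerivAt v (v' x) x) (hv' : Continuous v') :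
    ∫ x in a..b, F x * v' x = F b * v b - F a * v a - ∫ x in a..b, u x * v x := by
  set G : ℝ → ℝ := fun x => c + ∫ t in a..x, u t with hG
  have hFG : ∀ x ∈ Icc a b, F x = G x := hF
  have hGac : AbsolutelyContinuousOnInterval G a b := by
    have h1 := hu.absolutelyContinuousOnInterval_intervalIntegral (c := a) (by simp)
    have h2 : AbsolutelyContinuousOnInterval (fun _ : ℝ => c) a b :=
      (contDiff_const (n := 1)).contDiffOn.absolutelyContinuousOnInterval
    exact h2.add h1
  have hvac : AbsolutelyContinuousOnInterval v a b := by
    refine ContDiffOn.absolutelyContinuousOnInterval (ContDiff.contDiffOn ?_)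
    rw [contDiff_one_iff_deriv]
    refine ⟨fun x => (hv x).differentiableAt, ?_⟩
    rwa [show deriv v = v' from funext fun x => (hv x).deriv]
  have key := hGac.integral_mul_deriv_eq_deriv_mul hvac
  rw [show deriv v = v' from funext fun x => (hv x).deriv] at key
  rw [hFG b (right_mem_Icc.2 hab), hFG a (left_mem_Icc.2 hab)]
  have e1 : ∫ x in a..b, F x * v' x = ∫ x in a..b, G x * v' x := by
    refine integral_congr fun x hx => ?_
    rw [uIcc_of_le hab] at hx
    simp only [hFG x hx]
  have e2 : ∫ x in a..b, deriv G x * v x = ∫ x in a..b, u x * v x := by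
    refine integral_congr_ae ?_
    filter_upwards [hu.ae_hasDerivAt_integral] with x hx hxm
    have := (hx (uIoc_subset_uIcc hxm) a (by simp)).const_add c
    rw [this.deriv]
  rw [e1, key, e2]

/-- Substitution `x = 1 / 2 + cos t / 2`. -/
lemma integral_half_cos (g : ℝ → ℝ) {t : ℝ} (ht : t ∈ Icc 0 Real.pi) :
    ∫ x in (1 : ℝ)..(1 / 2 + 1 / 2 * Real.cos t), g x =
      ∫ s in (0 : ℝ)..t, g (1 / 2 + 1 / 2 * Real.cos s) * (-(1 / 2 * Real.sin s)) := by
  have := integral_comp_mul_deriv_of_deriv_nonpos (a := 0) (b := t) (g := g)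
    (f := fun t => 1 / 2 + 1 / 2 * Real.cos t) (f' := fun t => -(1 / 2 * Real.sin t))
    (by fun_prop) (fun x _ => hasDerivAt_half_cos x) (fun x hx => ?_)
  · simp only [Function.comp_def, Real.cos_zero] at this
    rw [this]; norm_num
  · rw [min_eq_left ht.1, max_eq_right ht.1] at hx
    have := Real.sin_nonneg_of_nonneg_of_le_pi hx.1.le (hx.2.le.trans ht.2)
    linarith

lemma intervalIntegrable_half_cos {g : ℝ → ℝ} (hg : IntervalIntegrable g volume 0 1) :
    IntervalIntegrable (fun s => g (1 / 2 + 1 / 2 * Real.cos s) * (-(1 / 2 * Real.sin s)))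
      volume 0 Real.pi := by
  have := integrable_comp_mul_deriv_iff_of_deriv_nonpos (a := 0) (b := Real.pi) (g := g)
    (f := fun t => 1 / 2 + 1 / 2 * Real.cos t) (f' := fun t => -(1 / 2 * Real.sin t))
    (by fun_prop) (fun x _ => hasDerivAt_half_cos x) (fun x hx => ?_)
  · simp only [Function.comp_def, Real.cos_zero, Real.cos_pi] at this
    rw [this]; norm_num; exact hg.symm
  · rw [min_eq_left Real.pi_pos.le, max_eq_right Real.pi_pos.le] at hx
    have := Real.sin_nonneg_of_nonneg_of_le_pi hx.1.le hx.2.le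
    linarith

/-- Integration by parts against sin(nt)/n, whose boundary terms vanish at 0 and π. The chain rule
contributes sin(t)/2, and 2 sin t sin nt = cos((n-1)t) - cos((n+1)t) gives the remaining factor 1/2.
-/
lemma cosCoeff_of_primitive {f g : ℝ → ℝ} (hg : IntervalIntegrable g volume 0 1)
    (hgc : ∀ n : ℤ, IntervalIntegrable
      (fun t => g (1 / 2 + 1 / 2 * Real.cos t) * Real.cos (n * t)) volume 0 Real.pi)
    (hf : ∀ x ∈ Icc (0 : ℝ) 1, f x = f 0 + ∫ t in (0 : ℝ)..x, g t) {n : ℤ} (hn : n ≠ 0) :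
    cosCoeff f n = (cosCoeff g (n - 1) - cosCoeff g (n + 1)) / (4 * n) := by
  have hn' : (n : ℝ) ≠ 0 := by exact_mod_cast hn
  have hsub : ∀ x ∈ Icc (0 : ℝ) 1, IntervalIntegrable g volume 0 x := fun x hx =>
    hg.mono_set (by rw [uIcc_of_le hx.1, uIcc_of_le zero_le_one]; exact Icc_subset_Icc_right hx.2)
  have hF : ∀ t ∈ Icc 0 Real.pi, f (1 / 2 + 1 / 2 * Real.cos t) = f 1 +
      ∫ s in (0 : ℝ)..t, g (1 / 2 + 1 / 2 * Real.cos s) * (-(1 / 2 * Real.sin s)) := by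
    intro t ht
    rw [← integral_half_cos g ht, hf _ (half_cos_mem t), hf 1 (by simp)]
    rw [← integral_add_adjacent_intervals hg ((hg.symm).trans (hsub _ (half_cos_mem t)))]
    ring
  have hv : ∀ x : ℝ, HasDerivAt (fun t : ℝ => Real.sin (n * t) / n) (Real.cos (n * x)) x := by
    intro x
    have := (((hasDerivAt_id x).const_mul (n : ℝ)).sin).div_const (n : ℝ)
    refine this.congr_deriv ?_
    simp [hn']
  have key := integral_primitive_mul_deriv Real.pi_pos.le (intervalIntegrable_half_cos hg) hF hv
    (by fun_prop)
  unfold cosCoeff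
  rw [key, ← integral_sub (hgc _) (hgc _), ← intervalIntegral.integral_div]
  simp only [Real.sin_int_mul_pi, mul_zero, Real.sin_zero, zero_div, sub_self, zero_sub,
    ← intervalIntegral.integral_neg]
  congr 1
  ext t
  push_cast
  rw [show ((n : ℝ) - 1) * t = n * t - t by ring, show ((n : ℝ) + 1) * t = n * t + t by ring,
    Real.cos_sub, Real.cos_add]
  field_simp
  ring

/-- A shift by the half period h = π/n reverses the sign of the cosine. Twice the integral is then
the integral of (H(t) - H(t+h)) cos(nt) up to two end pieces of length h. The difference is
nonnegative, so its integral telescopes to at most 2Mh. The shift leaves [0, π], which is why H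
lives on the whole line. -/
lemma abs_integral_antitone_mul_cos_le {H : ℝ → ℝ} {M : ℝ} (hH : Antitone H)
    (hM : ∀ t, |H t| ≤ M) {n : ℕ} (hn : 0 < n) :
    |∫ t in (0 : ℝ)..Real.pi, H t * Real.cos (n * t)| ≤ 2 * Real.pi * M / n := by
  have hn0 : (0 : ℝ) < n := by exact_mod_cast hn
  set h : ℝ := Real.pi / n with hh
  have hpos : 0 < h := by positivity
  have hiH : ∀ a b, IntervalIntegrable H volume a b := fun a b => hH.intervalIntegrable
  have hHh : Antitone fun t => H (t + h) := fun x y hxy => hH (by linarith)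
  have hiHh : ∀ a b, IntervalIntegrable (fun t => H (t + h)) volume a b :=
    fun a b => hHh.intervalIntegrable
  have hc : Continuous fun t : ℝ => Real.cos (n * t) := by fun_prop
  have hi1 : ∀ a b, IntervalIntegrable (fun t => H t * Real.cos (n * t)) volume a b :=
    fun a b => (hiH a b).mul_continuousOn hc.continuousOn
  have hi2 : ∀ a b, IntervalIntegrable (fun t => H (t + h) * Real.cos (n * t)) volume a b :=
    fun a b => (hiHh a b).mul_continuousOn hc.continuousOn
  have hshift : ∫ t in (0 : ℝ)..Real.pi, H t * Real.cos (n * t) =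
      -∫ t in (-h)..(Real.pi - h), H (t + h) * Real.cos (n * t) := by
    have := integral_comp_add_right (a := -h) (b := Real.pi - h)
      (fun t => H t * Real.cos (n * t)) h
    simp only [neg_add_cancel, sub_add_cancel] at this
    rw [← this, ← intervalIntegral.integral_neg]
    congr 1
    ext t
    rw [show (n : ℝ) * (t + h) = n * t + Real.pi by rw [hh]; field_simp, Real.cos_add_pi]
    ring
  have hcos : ∀ t, |H t * Real.cos (n * t)| ≤ M := fun t => by
    rw [abs_mul]
    calc |H t| * |Real.cos (n * t)| ≤ |H t| * 1 := by
          gcongr; exact Real.abs_cos_le_one _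
      _ ≤ M := by rw [mul_one]; exact hM t
  have hcos2 : ∀ t, |H (t + h) * Real.cos (n * t)| ≤ M := fun t => by
    rw [abs_mul]
    calc |H (t + h)| * |Real.cos (n * t)| ≤ |H (t + h)| * 1 := by
          gcongr; exact Real.abs_cos_le_one _
      _ ≤ M := by rw [mul_one]; exact hM _
  have hsplit : ∫ t in (-h)..(Real.pi - h), H (t + h) * Real.cos (n * t) =
      (∫ t in (0 : ℝ)..Real.pi, H (t + h) * Real.cos (n * t)) +
      (∫ t in (-h)..0, H (t + h) * Real.cos (n * t)) -
      ∫ t in (Real.pi - h)..Real.pi, H (t + h) * Real.cos (n * t) := by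
    have e1 := integral_add_adjacent_intervals (hi2 (-h) 0) (hi2 0 Real.pi)
    have e2 := integral_add_adjacent_intervals (hi2 (-h) (Real.pi - h)) (hi2 (Real.pi - h) Real.pi)
    linarith
  have b1 : |∫ t in (-h)..0, H (t + h) * Real.cos (n * t)| ≤ M * h := by
    have := norm_integral_le_of_norm_le_const (a := -h) (b := 0) (C := M)
      (f := fun t => H (t + h) * Real.cos (n * t)) (fun t _ => hcos2 t)
    simpa [abs_of_pos hpos] using this
  have b2 : |∫ t in (Real.pi - h)..Real.pi, H (t + h) * Real.cos (n * t)| ≤ M * h := by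
    have := norm_integral_le_of_norm_le_const (a := Real.pi - h) (b := Real.pi) (C := M)
      (f := fun t => H (t + h) * Real.cos (n * t)) (fun t _ => hcos2 t)
    simpa [abs_of_pos hpos] using this
  have b3 : |(∫ t in (0 : ℝ)..Real.pi, H t * Real.cos (n * t)) -
      ∫ t in (0 : ℝ)..Real.pi, H (t + h) * Real.cos (n * t)| ≤ 2 * (M * h) := by
    rw [← integral_sub (hi1 _ _) (hi2 _ _)]
    calc |∫ t in (0 : ℝ)..Real.pi, (H t * Real.cos (n * t) - H (t + h) * Real.cos (n * t))|
        ≤ ∫ t in (0 : ℝ)..Real.pi, (H t - H (t + h)) := by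
          rw [← Real.norm_eq_abs]
          refine norm_integral_le_of_norm_le Real.pi_pos.le (ae_of_all _ fun t _ => ?_)
            ((hiH _ _).sub (hiHh _ _))
          have hnn : 0 ≤ H t - H (t + h) := sub_nonneg.2 (hH (by linarith))
          rw [← sub_mul, norm_mul, Real.norm_of_nonneg hnn]
          calc _ ≤ (H t - H (t + h)) * 1 := by
                gcongr; exact Real.abs_cos_le_one _
            _ = _ := mul_one _
      _ = (∫ t in (0 : ℝ)..h, H t) - ∫ t in Real.pi..(Real.pi + h), H t := by
          rw [integral_sub (hiH _ _) (hiHh _ _), integral_comp_add_right H h]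
          have e1 := integral_add_adjacent_intervals (hiH 0 h) (hiH h (Real.pi + h))
          have e2 := integral_add_adjacent_intervals (hiH 0 Real.pi) (hiH Real.pi (Real.pi + h))
          rw [zero_add]
          linarith
      _ ≤ 2 * (M * h) := by
          have c1 := norm_integral_le_of_norm_le_const (a := 0) (b := h) (C := M)
            (f := H) (fun t _ => hM t)
          have c2 := norm_integral_le_of_norm_le_const (a := Real.pi) (b := Real.pi + h) (C := M)
            (f := H) (fun t _ => hM t)
          simp only [sub_zero, add_sub_cancel_left, abs_of_pos hpos, Real.norm_eq_abs] at c1 c2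
          linarith [(abs_le.1 c1).2, (abs_le.1 c2).1]
  have : 2 * Real.pi * M / n = 2 * (M * h) := by rw [hh]; ring
  rw [this]
  rw [abs_le] at *
  constructor <;> linarith [b1.1, b1.2, b2.1, b2.2, b3.1, b3.2]

/-- A monotone function on `[0, 1]`, composed with `t ↦ 1 / 2 + cos t / 2` on `[0, π]`, extends to
a bounded antitone function on the line. -/
lemma exists_antitone_half_cos {p : ℝ → ℝ} (hp : MonotoneOn p (Icc 0 1)) :
    ∃ (H : ℝ → ℝ) (M : ℝ), Antitone H ∧ (∀ t, |H t| ≤ M) ∧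
      ∀ t ∈ Icc 0 Real.pi, H t = p (1 / 2 + 1 / 2 * Real.cos t) := by
  refine ⟨fun t => p (1 / 2 + 1 / 2 * Real.cos (projIcc 0 Real.pi Real.pi_pos.le t)),
    |p 0| + |p 1|, ?_, ?_, ?_⟩
  · intro x y hxy
    refine hp (half_cos_mem _) (half_cos_mem _) ?_
    have h1 : (projIcc 0 Real.pi Real.pi_pos.le x : ℝ) ≤ projIcc 0 Real.pi Real.pi_pos.le y :=
      monotone_projIcc _ hxy
    have := Real.strictAntiOn_cos.antitoneOn (projIcc 0 Real.pi Real.pi_pos.le x).2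
      (projIcc 0 Real.pi Real.pi_pos.le y).2 h1
    linarith
  · intro t
    set x := 1 / 2 + 1 / 2 * Real.cos (projIcc 0 Real.pi Real.pi_pos.le t) with hx
    have hm : x ∈ Icc (0 : ℝ) 1 := half_cos_mem _
    have h0 := hp (left_mem_Icc.2 zero_le_one) hm hm.1
    have h1 := hp hm (right_mem_Icc.2 zero_le_one) hm.2
    change |p x| ≤ _
    rw [abs_le]
    constructor <;>
      linarith [neg_abs_le (p 0), le_abs_self (p 1), abs_nonneg (p 0), abs_nonneg (p 1)]
  · intro t ht
    simp only [projIcc_of_mem Real.pi_pos.le ht]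

lemma intervalIntegrable_monotoneOn_half_cos {p : ℝ → ℝ} (hp : MonotoneOn p (Icc 0 1)) (n : ℤ) :
    IntervalIntegrable (fun t => p (1 / 2 + 1 / 2 * Real.cos t) * Real.cos (n * t)) volume
      0 Real.pi := by
  obtain ⟨H, M, hH, -, hHp⟩ := exists_antitone_half_cos hp
  have h1 : IntervalIntegrable (fun t => H t * Real.cos (n * t)) volume 0 Real.pi :=
    (hH.intervalIntegrable).mul_continuousOn (by fun_prop)
  refine h1.congr fun t ht => ?_
  rw [uIoc_of_le Real.pi_pos.le] at ht
  simp only [hHp t ⟨ht.1.le, ht.2⟩]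

lemma exists_abs_cosCoeff_le_of_monotoneOn {p : ℝ → ℝ} (hp : MonotoneOn p (Icc 0 1)) :
    ∃ C, ∀ n : ℤ, |cosCoeff p n| * |(n : ℝ)| ≤ C := by
  obtain ⟨H, M, hH, hM, hHp⟩ := exists_antitone_half_cos hp
  have hM0 : 0 ≤ M := (abs_nonneg _).trans (hM 0)
  refine ⟨2 * Real.pi * M, ?_⟩
  have key : ∀ n : ℕ, |cosCoeff p n| * |((n : ℤ) : ℝ)| ≤ 2 * Real.pi * M := by
    intro n
    rcases Nat.eq_zero_or_pos n with rfl | hn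
    · simp; positivity
    · have := abs_integral_antitone_mul_cos_le hH hM hn
      have hn0 : (0 : ℝ) < n := by exact_mod_cast hn
      rw [le_div_iff₀ hn0] at this
      have e : cosCoeff p n = ∫ t in (0 : ℝ)..Real.pi, H t * Real.cos (n * t) := by
        refine integral_congr fun t ht => ?_
        rw [uIcc_of_le Real.pi_pos.le] at ht
        simp only [hHp t ht]
        norm_cast
      rw [e]
      simpa using this
  intro n
  obtain ⟨m, rfl | rfl⟩ := n.eq_nat_or_neg
  · exact key m
  · rw [cosCoeff_neg]
    simpa using key m

/-- `|a_n| (1 + |n|)^j` is bounded. -/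
def CoeffDecay (f : ℝ → ℝ) (j : ℕ) : Prop :=
  ∃ C, ∀ n : ℤ, |cosCoeff f n| * (1 + |(n : ℝ)|) ^ j ≤ C

lemma coeffDecay_of_abs_mul_le {f : ℝ → ℝ} {j : ℕ} {C : ℝ}
    (h : ∀ n : ℤ, n ≠ 0 → |cosCoeff f n| * |(n : ℝ)| ^ j ≤ C) : CoeffDecay f j := by
  have hC : 0 ≤ C := le_trans (by positivity) (h 1 one_ne_zero)
  -- The first term covers n = 0; the factor 2 ^ j comes from 1 + |n| ≤ 2|n| for n ≠ 0.
  refine ⟨|cosCoeff f 0| + 2 ^ j * C, fun n => ?_⟩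
  rcases eq_or_ne n 0 with rfl | hn
  · simp only [Int.cast_zero, abs_zero, add_zero, one_pow, mul_one, le_add_iff_nonneg_right]
    positivity
  · have h1 : (1 : ℝ) ≤ |(n : ℝ)| := by exact_mod_cast Int.one_le_abs hn
    calc |cosCoeff f n| * (1 + |(n : ℝ)|) ^ j ≤ |cosCoeff f n| * (2 * |(n : ℝ)|) ^ j := by
          gcongr; linarith
      _ = 2 ^ j * (|cosCoeff f n| * |(n : ℝ)| ^ j) := by rw [mul_pow]; ring
      _ ≤ 2 ^ j * C := by gcongr; exact h n hn
      _ ≤ _ := le_add_of_nonneg_left (abs_nonneg _)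

/-- The recurrence gains the factor 1/n. The weight 1 + |n| absorbs the index shifts, since |n| ≤ 1
+ |n ± 1| even where n ± 1 = 0. -/
lemma CoeffDecay.succ_of_primitive {f g : ℝ → ℝ} {j : ℕ} (h : CoeffDecay g j)
    (hg : IntervalIntegrable g volume 0 1)
    (hgc : ∀ n : ℤ, IntervalIntegrable
      (fun t => g (1 / 2 + 1 / 2 * Real.cos t) * Real.cos (n * t)) volume 0 Real.pi)
    (hf : ∀ x ∈ Icc (0 : ℝ) 1, f x = f 0 + ∫ t in (0 : ℝ)..x, g t) : CoeffDecay f (j + 1) := by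
  obtain ⟨C, hC⟩ := h
  refine coeffDecay_of_abs_mul_le (C := C / 2) fun n hn => ?_
  have h1 : (1 : ℝ) ≤ |(n : ℝ)| := by exact_mod_cast Int.one_le_abs hn
  rw [cosCoeff_of_primitive hg hgc hf hn, abs_div, abs_mul, abs_of_pos (four_pos : (0 : ℝ) < 4)]
  have b1 : |cosCoeff g (n - 1)| * |(n : ℝ)| ^ j ≤ C := by
    refine le_trans ?_ (hC (n - 1))
    gcongr
    push_cast
    have := abs_add_le ((n : ℝ) - 1) 1
    simp only [sub_add_cancel, abs_one] at this
    linarith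
  have b2 : |cosCoeff g (n + 1)| * |(n : ℝ)| ^ j ≤ C := by
    refine le_trans ?_ (hC (n + 1))
    gcongr
    push_cast
    have := abs_sub ((n : ℝ) + 1) 1
    simp only [add_sub_cancel_right, abs_one] at this
    linarith
  have h0 : |(n : ℝ)| ≠ 0 := by positivity
  calc |cosCoeff g (n - 1) - cosCoeff g (n + 1)| / (4 * |(n : ℝ)|) * |(n : ℝ)| ^ (j + 1)
      = |cosCoeff g (n - 1) - cosCoeff g (n + 1)| * |(n : ℝ)| ^ j / 4 := by
        field_simp
        ring
    _ ≤ (|cosCoeff g (n - 1)| + |cosCoeff g (n + 1)|) * |(n : ℝ)| ^ j / 4 := by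
        gcongr; exact abs_sub _ _
    _ ≤ C / 2 := by rw [add_mul]; linarith

/-- By Jordan decomposition, everything reduces to monotone functions. -/
lemma coeffDecay_one_of_boundedVariationOn {g : ℝ → ℝ} (hg : BoundedVariationOn g (Icc 0 1)) :
    CoeffDecay g 1 ∧ IntervalIntegrable g volume 0 1 ∧ ∀ n : ℤ, IntervalIntegrable
      (fun t => g (1 / 2 + 1 / 2 * Real.cos t) * Real.cos (n * t)) volume 0 Real.pi := by
  obtain ⟨p, q, hp, hq, rfl⟩ := hg.locallyBoundedVariationOn.exists_monotoneOn_sub_monotoneOn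
  have hip := intervalIntegrable_monotoneOn_half_cos hp
  have hiq := intervalIntegrable_monotoneOn_half_cos hq
  obtain ⟨C1, h1⟩ := exists_abs_cosCoeff_le_of_monotoneOn hp
  obtain ⟨C2, h2⟩ := exists_abs_cosCoeff_le_of_monotoneOn hq
  have e : ∀ n, cosCoeff (p - q) n = cosCoeff p n - cosCoeff q n := fun n => by
    unfold cosCoeff
    rw [← integral_sub (hip n) (hiq n)]
    simp [sub_mul]
  refine ⟨coeffDecay_of_abs_mul_le (C := C1 + C2) fun n _ => ?_, ?_, fun n => ?_⟩
  · calc |cosCoeff (p - q) n| * |(n : ℝ)| ^ 1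
        ≤ (|cosCoeff p n| + |cosCoeff q n|) * |(n : ℝ)| := by
          rw [pow_one, e]; gcongr; exact abs_sub _ _
      _ ≤ C1 + C2 := by rw [add_mul]; exact add_le_add (h1 n) (h2 n)
  · refine IntervalIntegrable.sub ?_ ?_
    · exact MonotoneOn.intervalIntegrable (by rwa [uIcc_of_le zero_le_one])
    · exact MonotoneOn.intervalIntegrable (by rwa [uIcc_of_le zero_le_one])
  · simpa [sub_mul] using (hip n).sub (hiq n)

/-- The representative g of bounded variation has decay 1. Absolute continuity makes f^(k-1) a
primitive of g, and descending to f takes k - 1 further classical integrations. -/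
theorem HasBVDeriv.coeffDecay {k : ℕ} {f : ℝ → ℝ} (hk : 1 ≤ k) (hf : HasBVDeriv k f) :
    CoeffDecay f (k + 1) := by
  obtain ⟨m, rfl⟩ : ∃ m, k = m + 1 := ⟨k - 1, by omega⟩
  obtain ⟨g, hg, hfg⟩ := hf.boundedVariation
  have hcd := hf.contDiffOn
  have hac := hf.absolutelyContinuous
  simp only [Nat.add_sub_cancel] at hcd hac hfg
  set D : ℕ → ℝ → ℝ := fun i => iteratedDerivWithin i f (Icc 0 1) with hD
  have hU : UniqueDiffOn ℝ (Icc (0 : ℝ) 1) := uniqueDiffOn_Icc zero_lt_one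
  have hcont : ∀ i ≤ m, ContinuousOn (D i) (Icc 0 1) := fun i hi =>
    hcd.continuousOn_iteratedDerivWithin (by exact_mod_cast hi) hU
  have htop : CoeffDecay (D m) 2 := by
    obtain ⟨hd, hint, hcint⟩ := coeffDecay_one_of_boundedVariationOn hg
    refine hd.succ_of_primitive hint hcint fun x hx => ?_
    have hacx : AbsolutelyContinuousOnInterval (D m) 0 x :=
      hac.mono (by rw [uIcc_of_le hx.1, uIcc_of_le zero_le_one]; exact Icc_subset_Icc_right hx.2)
    have h1 := hacx.integral_deriv_eq_sub
    have h2 : ∫ t in (0 : ℝ)..x, deriv (D m) t = ∫ t in (0 : ℝ)..x, g t := by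
      refine integral_congr_ae ?_
      rw [ae_restrict_iff' measurableSet_Icc] at hfg
      -- At interior points the derivative within [0, 1] is a genuine derivative; the end point 1 is
      -- discarded as a null set.
      have hne : ∀ᵐ t : ℝ, t ≠ 1 := by simp [ae_iff, measure_singleton]
      filter_upwards [hfg, hne] with t ht ht1 htm
      rw [uIoc_of_le hx.1] at htm
      have htI : t ∈ Icc (0 : ℝ) 1 := ⟨htm.1.le, htm.2.trans hx.2⟩
      exact ((ht htI).hasDerivAt
        (Icc_mem_nhds htm.1 (lt_of_le_of_ne htI.2 ht1))).deriv
    rw [← h2, h1]; ring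
  have key : ∀ i ≤ m, CoeffDecay (D (m - i)) (i + 2) := by
    intro i
    induction i with
    | zero => intro _; exact htop
    | succ i ih =>
      intro hi
      have hi' := ih (by omega)
      set l := m - (i + 1) with hl
      have hl1 : m - i = l + 1 := by omega
      rw [hl1] at hi'
      have hc1 := hcont (l + 1) (by omega)
      have hsub : ∀ x ∈ Icc (0 : ℝ) 1, Icc 0 x ⊆ Icc (0 : ℝ) 1 := fun x hx =>
        Icc_subset_Icc_right hx.2
      refine hi'.succ_of_primitive (ContinuousOn.intervalIntegrable ?_) (fun n => ?_) fun x hx => ?_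
      · rwa [uIcc_of_le zero_le_one]
      · refine ContinuousOn.intervalIntegrable (ContinuousOn.mul ?_ (by fun_prop))
        exact hc1.comp (by fun_prop) fun t _ => half_cos_mem t
      · have := integral_eq_sub_of_hasDerivAt_of_le (f := D l) (f' := D (l + 1)) hx.1
          ((hcont l (by omega)).mono (hsub x hx)) (fun t ht => ?_)
          (ContinuousOn.intervalIntegrable (by rw [uIcc_of_le hx.1]; exact hc1.mono (hsub x hx)))
        · rw [this]; ring
        · have htI : t ∈ Icc (0 : ℝ) 1 := ⟨ht.1.le, ht.2.le.trans hx.2⟩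
          have hdiff : DifferentiableWithinAt ℝ (D l) (Icc 0 1) t :=
            hcd.differentiableOn_iteratedDerivWithin
              (by exact_mod_cast (by omega : l < m)) hU t htI
          have h3 := hdiff.hasDerivWithinAt
          rw [show derivWithin (D l) (Icc 0 1) t = D (l + 1) t by
            simp only [hD, iteratedDerivWithin_succ]] at h3
          exact h3.hasDerivAt (Icc_mem_nhds ht.1 (ht.2.trans_le hx.2))
  have := key m le_rfl
  simpa only [hD, Nat.sub_self, iteratedDerivWithin_zero] using this

/-! ### Chebyshev series and aliasing. -/

lemma HasBVDeriv.continuousOn {k : ℕ} {f : ℝ → ℝ} (hf : HasBVDeriv k f) :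
    ContinuousOn f (Icc 0 1) := hf.contDiffOn.continuousOn

lemma CoeffDecay.mono {f : ℝ → ℝ} {i j : ℕ} (h : CoeffDecay f j) (hij : i ≤ j) :
    CoeffDecay f i := by
  obtain ⟨C, hC⟩ := h
  refine ⟨C, fun n => le_trans ?_ (hC n)⟩
  gcongr
  linarith [abs_nonneg (n : ℝ)]

lemma CoeffDecay.summable {f : ℝ → ℝ} (h : CoeffDecay f 2) : Summable fun n => |cosCoeff f n| := by
  obtain ⟨C, hC⟩ := h
  have hs : Summable fun n : ℤ => C * (1 / (n : ℝ) ^ 2) :=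
    (Real.summable_one_div_int_pow.2 one_lt_two).mul_left C
  refine Summable.of_norm_bounded_eventually hs ?_
  filter_upwards [(Set.finite_singleton (0 : ℤ)).compl_mem_cofinite] with n hn
  have hn0 : n ≠ 0 := by simpa using hn
  have h1 : (0 : ℝ) < |(n : ℝ)| := by positivity
  rw [Real.norm_of_nonneg (abs_nonneg _), mul_one_div, le_div_iff₀ (by positivity), ← sq_abs]
  refine le_trans ?_ (hC n)
  gcongr
  linarith

lemma continuous_half_cos {f : ℝ → ℝ} (hf : ContinuousOn f (Icc 0 1)) :
    Continuous fun t => f (1 / 2 + 1 / 2 * Real.cos t) :=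
  hf.comp_continuous (by fun_prop) half_cos_mem

/-- A continuous function on `[0, 1]` with quadratically decaying coefficients is the sum of its
Chebyshev series. -/
theorem hasSum_cosCoeff {f : ℝ → ℝ} (hf : ContinuousOn f (Icc 0 1)) (hs : CoeffDecay f 2) (t : ℝ) :
    HasSum (fun n : ℤ => cosCoeff f n / Real.pi * Real.cos (n * t))
      (f (1 / 2 + 1 / 2 * Real.cos t)) := by
  have : Fact (0 < 2 * Real.pi) := ⟨Real.two_pi_pos⟩
  set G : ℝ → ℂ := fun t => (f (1 / 2 + 1 / 2 * Real.cos t) : ℂ) with hG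
  have hGc : Continuous G := Complex.continuous_ofReal.comp (continuous_half_cos hf)
  have hGp : Function.Periodic G (2 * Real.pi) := fun t => by simp [hG]
  have hGe : ∀ t, G (-t) = G t := fun t => by simp [hG]
  let F : C(AddCircle (2 * Real.pi), ℂ) :=
    ⟨hGp.lift, continuous_coinduced_dom.2 hGc⟩
  have hFt : ∀ t : ℝ, F (t : AddCircle (2 * Real.pi)) = G t := fun t => rfl
  have hfour : ∀ (n : ℤ) (t : ℝ), fourier n (t : AddCircle (2 * Real.pi)) =
      Complex.cos (n * t) + Complex.sin (n * t) * Complex.I := fun n t => by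
    rw [fourier_coe_apply, ← Complex.exp_mul_I]
    congr 1
    have : (Real.pi : ℂ) ≠ 0 := by exact_mod_cast Real.pi_ne_zero
    push_cast
    field_simp
  -- Evenness folds [-π, 0] onto [0, π], which cancels the sines and doubles the cosines, so that
  -- 1/(2π) becomes 1/π.
  have hcoef : ∀ n, fourierCoeff F n = ((cosCoeff f n / Real.pi : ℝ) : ℂ) := by
    intro n
    rw [fourierCoeff_eq_intervalIntegral F n (-Real.pi),
      show -Real.pi + 2 * Real.pi = Real.pi by ring]
    simp only [hFt, hfour]
    set K : ℝ → ℂ := fun x => (Complex.cos (((-n : ℤ) : ℂ) * x) +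
      Complex.sin (((-n : ℤ) : ℂ) * x) * Complex.I) • G x with hK
    have hKc : Continuous K := by
      simp only [hK, smul_eq_mul]
      fun_prop
    rw [← integral_add_adjacent_intervals (hKc.intervalIntegrable (-Real.pi) 0)
      (hKc.intervalIntegrable 0 Real.pi)]
    have e1 : ∫ x in (-Real.pi)..0, K x = ∫ x in (0 : ℝ)..Real.pi, K (-x) := by
      rw [integral_comp_neg]; simp
    rw [e1, ← integral_add ((show Continuous fun x => K (-x) from hKc.comp continuous_neg).intervalIntegrable 0 Real.pi)
      (hKc.intervalIntegrable 0 Real.pi)]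
    have e2 : ∀ x : ℝ, K (-x) + K x =
        ((2 * (f (1 / 2 + 1 / 2 * Real.cos x) * Real.cos (n * x)) : ℝ) : ℂ) := fun x => by
      simp only [hK, hGe]
      simp only [hG, smul_eq_mul]
      push_cast
      simp
      ring
    simp only [e2]
    rw [integral_ofReal, intervalIntegral.integral_const_mul]
    unfold cosCoeff
    rw [Complex.real_smul, ← Complex.ofReal_mul]
    congr 1
    field_simp
  have hsum : Summable (fourierCoeff F) := by
    refine Summable.of_norm ?_
    simp only [hcoef, Complex.norm_real, norm_div, Real.norm_eq_abs]
    exact hs.summable.div_const _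
  have := Complex.hasSum_re (has_pointwise_sum_fourier_series_of_summable hsum (t : AddCircle _))
  rw [hFt] at this
  simp only [hG, Complex.ofReal_re] at this
  convert this using 2 with n
  rw [hcoef, hfour, smul_eq_mul, Complex.re_ofReal_mul]
  congr 1
  rw [Complex.add_re, ← Complex.ofReal_intCast, ← Complex.ofReal_mul, ← Complex.ofReal_cos,
    ← Complex.ofReal_sin, Complex.ofReal_re, Complex.re_ofReal_mul, Complex.I_re, mul_zero,
    add_zero]

lemma node_injOn {N : ℕ} (hN : 0 < N) : Set.InjOn (node N) (Finset.range (N + 1)) := by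
  have hN0 : (0 : ℝ) < N := by exact_mod_cast hN
  have hmem : ∀ i ∈ Finset.range (N + 1), (i : ℝ) * Real.pi / N ∈ Icc 0 Real.pi := fun i hi => by
    have : (i : ℝ) ≤ N := by exact_mod_cast Nat.lt_succ_iff.1 (Finset.mem_range.1 hi)
    refine ⟨by positivity, ?_⟩
    rw [div_le_iff₀ hN0, mul_comm]
    gcongr
  intro i hi j hj hij
  simp only [node] at hij
  have := Real.injOn_cos (hmem i hi) (hmem j hj) (by linarith)
  field_simp at this
  exact_mod_cast this

/-- The aliasing property of the Clenshaw-Curtis points. -/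
lemma eval_interpolate_cos {N : ℕ} (hN : 0 < N) {n r : ℤ} (hr : r.natAbs ≤ N)
    (hnr : (2 * N : ℤ) ∣ n - r) (t : ℝ) :
    (Lagrange.interpolate (Finset.range (N + 1)) (node N)
      (fun i => Real.cos (n * (i * Real.pi / N)))).eval (1 / 2 + 1 / 2 * Real.cos t) =
      Real.cos (r * t) := by
  -- T_r(2x - 1) has degree |r| ≤ N, so it is its own interpolant; only agreement at the nodes
  -- remains.
  set P : Polynomial ℝ := (Polynomial.Chebyshev.T ℝ r).comp
    (Polynomial.C 2 * Polynomial.X - Polynomial.C 1) with hP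
  have hPe : ∀ s, P.eval (1 / 2 + 1 / 2 * Real.cos s) = Real.cos (r * s) := fun s => by
    rw [hP, Polynomial.eval_comp, ← Polynomial.Chebyshev.T_real_cos]
    congr 1
    simp
    ring
  have hdeg : P.degree < (Finset.range (N + 1)).card := by
    rw [Finset.card_range]
    refine lt_of_le_of_lt Polynomial.degree_le_natDegree ?_
    rw [Polynomial.natDegree_comp, Polynomial.Chebyshev.natDegree_T]
    have : (Polynomial.C (2 : ℝ) * Polynomial.X - Polynomial.C 1).natDegree ≤ 1 := by
      compute_degree
    have h2 := Nat.mul_le_mul hr this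
    exact_mod_cast (by omega)
  have := Lagrange.eq_interpolate_of_eval_eq (s := Finset.range (N + 1)) (v := node N)
    (r := fun i : ℕ => Real.cos (n * (i * Real.pi / N))) (node_injOn hN) hdeg (fun i _ => by
      rw [node, hPe]
      obtain ⟨m, hm⟩ := hnr
      have hN0 : (N : ℝ) ≠ 0 := by positivity
      have hn : (n : ℝ) = r + 2 * N * m := by
        have : n = r + 2 * N * m := by linarith
        exact_mod_cast congrArg (Int.cast : ℤ → ℝ) this
      have : (n : ℝ) * (i * Real.pi / N) = r * (i * Real.pi / N) + ((m * i : ℤ) : ℝ) * (2 * Real.pi) := by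
        rw [hn]; push_cast; field_simp
      rw [this, Real.cos_add_int_mul_two_pi])
  rw [← this, hPe]

/-- Interpolation is a linear map of finitely many nodal values, so it may be applied termwise to
the Chebyshev series, and each term is then aliased. -/
theorem hasSum_interpolant {f : ℝ → ℝ} (hf : ContinuousOn f (Icc 0 1)) (hs : CoeffDecay f 2)
    {N : ℕ} (hN : 0 < N) {ρ : ℤ → ℤ} (hρ : ∀ n, (ρ n).natAbs ≤ N)
    (hρn : ∀ n, (2 * N : ℤ) ∣ n - ρ n) (t : ℝ) :
    HasSum (fun n : ℤ => cosCoeff f n / Real.pi * Real.cos (ρ n * t))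
      ((interpolant N f).eval (1 / 2 + 1 / 2 * Real.cos t)) := by
  set x := 1 / 2 + 1 / 2 * Real.cos t with hx
  have hlin : ∀ g : ℕ → ℝ, (Lagrange.interpolate (Finset.range (N + 1)) (node N) g).eval x =
      ∑ i ∈ Finset.range (N + 1),
        g i * (Lagrange.basis (Finset.range (N + 1)) (node N) i).eval x := fun g => by
    rw [Lagrange.interpolate_apply, Polynomial.eval_finsetSum]
    simp
  have h1 : HasSum (fun n : ℤ => ∑ i ∈ Finset.range (N + 1),
      cosCoeff f n / Real.pi * Real.cos (n * (i * Real.pi / N)) *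
        (Lagrange.basis (Finset.range (N + 1)) (node N) i).eval x)
      (∑ i ∈ Finset.range (N + 1), f (node N i) *
        (Lagrange.basis (Finset.range (N + 1)) (node N) i).eval x) :=
    hasSum_sum fun i _ => (hasSum_cosCoeff hf hs _).mul_right _
  rw [interpolant, hlin]
  convert h1 using 2 with n
  rw [← eval_interpolate_cos hN (hρ n) (hρn n) t, ← hx, hlin, Finset.mul_sum]
  exact Finset.sum_congr rfl fun i _ => by ring

/-! ### Oscillatory integrals with algebraic singularities. -/

lemma intervalIntegrable_of_abs_le_rpow {V : ℝ → ℝ} {L K μ : ℝ} (hL : 0 < L) (hμ : -1 < μ)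
    (hV : ContinuousOn V (Ioc 0 L)) (hb : ∀ t ∈ Ioc 0 L, |V t| ≤ K * t ^ μ) :
    IntervalIntegrable V volume 0 L := by
  refine ((intervalIntegrable_rpow' (a := 0) (b := L) hμ).const_mul K).mono_fun' ?_ ?_
  · rw [uIoc_of_le hL.le]
    exact hV.aestronglyMeasurable measurableSet_Ioc
  · rw [uIoc_of_le hL.le]
    exact (ae_restrict_iff' measurableSet_Ioc).2 (ae_of_all _ hb)

/-- Decay of the oscillatory integral of a function with an algebraic singularity at the left end
point. -/
lemma abs_integral_mul_cos_le_of_singularity {V V' : ℝ → ℝ} {L K μ : ℝ} (hL : 0 < L)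
    (hK : 0 ≤ K) (hμ : -1 < μ) (hμ0 : μ < 0) (hV : ∀ t ∈ Ioc 0 L, HasDerivAt V (V' t) t)
    (hV' : ContinuousOn V' (Ioc 0 L)) (hb : ∀ t ∈ Ioc 0 L, |V t| ≤ K * t ^ μ)
    (hb' : ∀ t ∈ Ioc 0 L, |V' t| ≤ K * t ^ (μ - 1)) {n : ℕ} (hn : 0 < n) (d : ℝ) :
    |∫ t in (0 : ℝ)..L, V t * Real.cos (n * t + d)| ≤
      K * (1 / (1 + μ) + (2 + 1 / -μ) / L) * L ^ (1 + μ) * (n : ℝ) ^ (-1 - μ) := by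
  have hn0 : (0 : ℝ) < n := by exact_mod_cast hn
  have hn1 : (1 : ℝ) ≤ n := by exact_mod_cast hn
  -- On [0, δ], of the order of one wavelength, the size of V suffices; on [δ, L] integration by
  -- parts gains 1/n. Both pieces have order δ^(1+μ).
  set δ : ℝ := L / n with hδ
  have hδ0 : 0 < δ := by positivity
  have hδL : δ ≤ L := div_le_self hL.le hn1
  have hVc : ContinuousOn V (Ioc 0 L) := fun t ht => (hV t ht).continuousAt.continuousWithinAt
  have hVi : IntervalIntegrable V volume 0 L := intervalIntegrable_of_abs_le_rpow hL hμ hVc hb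
  have hcos : Continuous fun t : ℝ => Real.cos (n * t + d) := by fun_prop
  have hsub1 : uIcc 0 δ ⊆ uIcc 0 L := by
    rw [uIcc_of_le hδ0.le, uIcc_of_le hL.le]; exact Icc_subset_Icc_right hδL
  have hsub2 : uIcc δ L ⊆ uIcc 0 L := by
    rw [uIcc_of_le hδL, uIcc_of_le hL.le]; exact Icc_subset_Icc_left hδ0.le
  have hsub3 : uIcc δ L ⊆ Ioc 0 L := by
    rw [uIcc_of_le hδL]; exact fun t ht => ⟨hδ0.trans_le ht.1, ht.2⟩
  have b1 : |∫ t in (0 : ℝ)..δ, V t * Real.cos (n * t + d)| ≤ K * (δ ^ (1 + μ) / (1 + μ)) := by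
    have h1 : ∫ t in (0 : ℝ)..δ, K * t ^ μ = K * (δ ^ (1 + μ) / (1 + μ)) := by
      rw [intervalIntegral.integral_const_mul, integral_rpow (Or.inl hμ),
        Real.zero_rpow (by linarith), sub_zero, add_comm μ 1]
    rw [← h1, ← Real.norm_eq_abs]
    refine norm_integral_le_of_norm_le hδ0.le (ae_of_all _ fun t ht => ?_)
      ((intervalIntegrable_rpow' hμ).const_mul K)
    rw [norm_mul]
    calc _ ≤ ‖V t‖ * 1 := by gcongr; exact Real.abs_cos_le_one _
      _ ≤ _ := by rw [mul_one]; exact hb t ⟨ht.1, ht.2.trans hδL⟩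
  have hv : ∀ x : ℝ, HasDerivAt (fun t : ℝ => Real.sin (n * t + d) / n)
      (Real.cos (n * x + d)) x := by
    intro x
    have := ((((hasDerivAt_id x).const_mul (n : ℝ)).add_const d).sin).div_const (n : ℝ)
    refine this.congr_deriv ?_
    simp [hn0.ne']
  have hV'i : IntervalIntegrable V' volume δ L := (hV'.mono hsub3).intervalIntegrable
  have hibp := integral_mul_deriv_eq_deriv_mul (a := δ) (b := L)
    (fun t ht => hV t (hsub3 ht)) (fun t _ => hv t) hV'i (hcos.intervalIntegrable _ _)
  have hδpow : δ ^ μ = δ ^ (1 + μ) * (n / L) := by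
    rw [Real.rpow_add hδ0, Real.rpow_one, hδ]; field_simp
  have hsin : ∀ x : ℝ, |Real.sin x / n| ≤ 1 / n := fun x => by
    rw [abs_div, abs_of_pos hn0]; gcongr; exact Real.abs_sin_le_one _
  have hanti : L ^ μ ≤ δ ^ μ := Real.rpow_le_rpow_of_nonpos hδ0 hδL hμ0.le
  have c1 : |V L * (Real.sin (n * L + d) / n)| ≤ K * δ ^ μ * (1 / n) := by
    rw [abs_mul]
    gcongr
    · exact (hb L ⟨hL, le_rfl⟩).trans (by gcongr)
    · exact hsin _
  have c2 : |V δ * (Real.sin (n * δ + d) / n)| ≤ K * δ ^ μ * (1 / n) := by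
    rw [abs_mul]
    gcongr
    · exact hb δ ⟨hδ0, hδL⟩
    · exact hsin _
  -- Since μ < 0, the integral of t^(μ-1) is dominated by its lower limit.
  have c3 : |∫ t in δ..L, V' t * (Real.sin (n * t + d) / n)| ≤
      K * δ ^ μ * (1 / n) * (1 / -μ) := by
    have h0 : (0 : ℝ) ∉ uIcc δ L := fun h => (hsub3 h).1.ne rfl
    have h1 : ∫ t in δ..L, K * t ^ (μ - 1) * (1 / n) =
        K * ((L ^ μ - δ ^ μ) / μ) * (1 / n) := by
      rw [intervalIntegral.integral_mul_const, intervalIntegral.integral_const_mul,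
        integral_rpow (Or.inr ⟨by linarith, h0⟩), sub_add_cancel]
    calc _ ≤ ∫ t in δ..L, K * t ^ (μ - 1) * (1 / n) := by
          rw [← Real.norm_eq_abs]
          refine norm_integral_le_of_norm_le hδL (ae_of_all _ fun t ht => ?_)
            (((intervalIntegrable_rpow (Or.inr h0)).const_mul K).mul_const _)
          have htm : t ∈ Ioc 0 L := ⟨hδ0.trans ht.1, ht.2⟩
          rw [norm_mul]
          refine mul_le_mul (hb' t htm) (hsin _) (norm_nonneg _) ?_
          have := Real.rpow_nonneg htm.1.le (μ - 1)
          positivity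
      _ = K * ((δ ^ μ - L ^ μ) * (1 / -μ)) * (1 / n) := by
          rw [h1]; field_simp; ring
      _ ≤ K * (δ ^ μ * (1 / -μ)) * (1 / n) := by
          have : 0 < 1 / -μ := by rw [one_div_pos]; linarith
          have := Real.rpow_nonneg hL.le μ
          gcongr
          linarith
      _ = _ := by ring
  have b2 : |∫ t in δ..L, V t * Real.cos (n * t + d)| ≤ K * δ ^ (1 + μ) * ((2 + 1 / -μ) / L) := by
    have : K * δ ^ (1 + μ) * ((2 + 1 / -μ) / L) = K * δ ^ μ * (1 / n) + K * δ ^ μ * (1 / n) +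
        K * δ ^ μ * (1 / n) * (1 / -μ) := by
      rw [hδpow]; field_simp; ring
    rw [this, hibp]
    refine (abs_sub _ _).trans ?_
    gcongr
    exact (abs_sub _ _).trans (add_le_add c1 c2)
  have hδ1 : δ ^ (1 + μ) = L ^ (1 + μ) * (n : ℝ) ^ (-1 - μ) := by
    rw [hδ, Real.div_rpow hL.le hn0.le, div_eq_mul_inv, ← Real.rpow_neg hn0.le]
    congr 2; ring
  rw [← integral_add_adjacent_intervals
    ((hVi.mono_set hsub1).mul_continuousOn hcos.continuousOn)
    ((hVi.mono_set hsub2).mul_continuousOn hcos.continuousOn)]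
  refine (abs_add_le _ _).trans ((add_le_add b1 b2).trans_eq ?_)
  rw [hδ1]; ring

lemma sin_half_mem {t : ℝ} (ht : t ∈ Ioc 0 (Real.pi / 2)) :
    t / Real.pi ≤ Real.sin (t / 2) ∧ 0 < Real.sin (t / 2) := by
  have h := Real.mul_le_sin (x := t / 2) (by linarith [ht.1]) (by linarith [ht.2, Real.pi_pos])
  have e : 2 / Real.pi * (t / 2) = t / Real.pi := by field_simp
  rw [e] at h
  exact ⟨h, lt_of_lt_of_le (div_pos ht.1 Real.pi_pos) h⟩

lemma hasDerivAt_sin_half (t : ℝ) :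
    HasDerivAt (fun t => Real.sin (t / 2)) (Real.cos (t / 2) / 2) t := by
  have := ((hasDerivAt_id t).div_const 2).sin
  refine this.congr_deriv ?_
  simp [div_eq_mul_inv]

lemma hasDerivAt_cos_half (t : ℝ) :
    HasDerivAt (fun t => Real.cos (t / 2)) (-Real.sin (t / 2) / 2) t := by
  have := ((hasDerivAt_id t).div_const 2).cos
  refine this.congr_deriv ?_
  simp [div_eq_mul_inv]

/-- From t/π ≤ sin(t/2) ≤ 1 the exponent can be lowered to μ and then, μ being negative, the base to
t/π. Allowing μ < q lets one μ serve both end points. -/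
lemma exists_rpow_bounds_sin_half {ψ ψ' : ℝ → ℝ} {q μ : ℝ} (hμq : μ ≤ q) (hμ0 : μ < 0)
    (hψ : ContinuousOn ψ (Icc 0 (Real.pi / 2))) (hψ' : ContinuousOn ψ' (Icc 0 (Real.pi / 2))) :
    ∃ K, 0 ≤ K ∧ ∀ t ∈ Ioc 0 (Real.pi / 2), |Real.sin (t / 2) ^ q * ψ t| ≤ K * t ^ μ ∧
      |q * Real.sin (t / 2) ^ (q - 1) * (Real.cos (t / 2) / 2) * ψ t +
        Real.sin (t / 2) ^ q * ψ' t| ≤ K * t ^ (μ - 1) := by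
  obtain ⟨B, hB⟩ := isCompact_Icc.exists_bound_of_continuousOn hψ
  obtain ⟨B', hB'⟩ := isCompact_Icc.exists_bound_of_continuousOn hψ'
  have hmem : (0 : ℝ) ∈ Icc 0 (Real.pi / 2) := ⟨le_rfl, by positivity⟩
  have hB0 : 0 ≤ B := (norm_nonneg _).trans (hB 0 hmem)
  have hB'0 : 0 ≤ B' := (norm_nonneg _).trans (hB' 0 hmem)
  refine ⟨B * Real.pi ^ (-μ) + (|q| * B + B') * Real.pi ^ (-(μ - 1)), by positivity,
    fun t ht => ?_⟩
  obtain ⟨hs, hs0⟩ := sin_half_mem ht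
  have hs1 := Real.sin_le_one (t / 2)
  have htI : t ∈ Icc 0 (Real.pi / 2) := ⟨ht.1.le, ht.2⟩
  have htp : 0 < t / Real.pi := div_pos ht.1 Real.pi_pos
  have hpow : ∀ r : ℝ, (t / Real.pi) ^ r = Real.pi ^ (-r) * t ^ r := fun r => by
    rw [Real.div_rpow ht.1.le Real.pi_pos.le, Real.rpow_neg Real.pi_pos.le, div_eq_mul_inv,
      mul_comm]
  have e1 : Real.sin (t / 2) ^ q ≤ Real.pi ^ (-μ) * t ^ μ := by
    rw [← hpow]
    exact (Real.rpow_le_rpow_of_exponent_ge hs0 hs1 hμq).trans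
      (Real.rpow_le_rpow_of_nonpos htp hs hμ0.le)
  have e2 : Real.sin (t / 2) ^ (q - 1) ≤ Real.pi ^ (-(μ - 1)) * t ^ (μ - 1) := by
    rw [← hpow]
    exact (Real.rpow_le_rpow_of_exponent_ge hs0 hs1 (by linarith)).trans
      (Real.rpow_le_rpow_of_nonpos htp hs (by linarith))
  have e3 : Real.sin (t / 2) ^ q ≤ Real.pi ^ (-(μ - 1)) * t ^ (μ - 1) :=
    (Real.rpow_le_rpow_of_exponent_ge hs0 hs1 (by linarith)).trans e2
  have p1 : 0 < t ^ μ := Real.rpow_pos_of_pos ht.1 _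
  have p2 : 0 < t ^ (μ - 1) := Real.rpow_pos_of_pos ht.1 _
  have p3 : 0 < Real.sin (t / 2) ^ q := Real.rpow_pos_of_pos hs0 _
  have p4 : 0 < Real.sin (t / 2) ^ (q - 1) := Real.rpow_pos_of_pos hs0 _
  have hψt : |ψ t| ≤ B := hB t htI
  have hψt' : |ψ' t| ≤ B' := hB' t htI
  constructor
  · rw [abs_mul, abs_of_pos p3]
    calc _ ≤ Real.pi ^ (-μ) * t ^ μ * B := by gcongr
      _ = B * Real.pi ^ (-μ) * t ^ μ := by ring
      _ ≤ _ := by gcongr; exact le_add_of_nonneg_right (by positivity)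
  · have hc : |Real.cos (t / 2) / 2| ≤ 1 := by
      rw [abs_div, abs_two]; linarith [Real.abs_cos_le_one (t / 2)]
    calc _ ≤ |q| * Real.sin (t / 2) ^ (q - 1) * 1 * B + Real.sin (t / 2) ^ q * B' := by
          refine (abs_add_le _ _).trans ?_
          rw [abs_mul, abs_mul, abs_mul, abs_mul, abs_of_pos p3, abs_of_pos p4]
          gcongr
      _ ≤ |q| * (Real.pi ^ (-(μ - 1)) * t ^ (μ - 1)) * 1 * B +
          Real.pi ^ (-(μ - 1)) * t ^ (μ - 1) * B' := by gcongr
      _ = (|q| * B + B') * Real.pi ^ (-(μ - 1)) * t ^ (μ - 1) := by ring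
      _ ≤ _ := by gcongr; exact le_add_of_nonneg_left (by positivity)

/-- The weight `cos(t/2)^p sin(t/2)^q Φ(t)`. -/
noncomputable def jacobiWeight (p q : ℝ) (Φ : ℝ → ℝ) (t : ℝ) : ℝ :=
  Real.cos (t / 2) ^ p * Real.sin (t / 2) ^ q * Φ t

lemma jacobiWeight_pi_sub (p q : ℝ) (Φ : ℝ → ℝ) (t : ℝ) :
    jacobiWeight p q Φ (Real.pi - t) = jacobiWeight q p (fun t => Φ (Real.pi - t)) t := by
  simp only [jacobiWeight, sub_div, Real.cos_pi_div_two_sub, Real.sin_pi_div_two_sub]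
  ring

lemma cos_half_pos {t : ℝ} (h0 : -Real.pi < t) (h1 : t < Real.pi) : 0 < Real.cos (t / 2) :=
  Real.cos_pos_of_mem_Ioo ⟨by linarith, by linarith⟩

lemma sin_half_pos {t : ℝ} (h0 : 0 < t) (h1 : t < 2 * Real.pi) : 0 < Real.sin (t / 2) :=
  Real.sin_pos_of_pos_of_lt_pi (by linarith) (by linarith)

/-- On this half only t = 0 is singular, since cos(t/2) stays away from 0; its power is absorbed
into the smooth factor ψ. The free phase d serves the reflection t ↦ π - t and the passage from
sines to cosines. -/
lemma jacobiWeight_half_decay {p q μ : ℝ} {Φ : ℝ → ℝ} (hΦ : ContDiff ℝ 1 Φ) (hμ : -1 < μ)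
    (hμ0 : μ < 0) (hq : μ ≤ q) :
    IntervalIntegrable (jacobiWeight p q Φ) volume 0 (Real.pi / 2) ∧
    ∃ C, ∀ n : ℕ, 0 < n → ∀ d : ℝ,
      |∫ t in (0 : ℝ)..Real.pi / 2, jacobiWeight p q Φ t * Real.cos (n * t + d)| ≤
        C * (n : ℝ) ^ (-1 - μ) := by
  have hL : 0 < Real.pi / 2 := by positivity
  set ψ : ℝ → ℝ := fun t => Real.cos (t / 2) ^ p * Φ t with hψ
  set ψ' : ℝ → ℝ := fun t => (-Real.sin (t / 2) / 2 * p * Real.cos (t / 2) ^ (p - 1)) * Φ t +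
    Real.cos (t / 2) ^ p * deriv Φ t with hψ'
  have hcos : ∀ t ∈ Icc 0 (Real.pi / 2), 0 < Real.cos (t / 2) := fun t ht =>
    cos_half_pos (by linarith [ht.1, Real.pi_pos]) (by linarith [ht.2, Real.pi_pos])
  have hdψ : ∀ t ∈ Icc 0 (Real.pi / 2), HasDerivAt ψ (ψ' t) t := fun t ht =>
    ((hasDerivAt_cos_half t).rpow_const (Or.inl (hcos t ht).ne')).mul
      (hΦ.differentiable one_ne_zero t).hasDerivAt
  have hcψ : ContinuousOn ψ (Icc 0 (Real.pi / 2)) := fun t ht =>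
    (hdψ t ht).continuousAt.continuousWithinAt
  have hΦ' : Continuous (deriv Φ) := hΦ.continuous_deriv le_rfl
  have hcΦ := hΦ.continuous
  have hcpow : ∀ r : ℝ, ContinuousOn (fun t => Real.cos (t / 2) ^ r) (Icc 0 (Real.pi / 2)) :=
    fun r => ContinuousOn.rpow_const (by fun_prop) fun t ht => Or.inl (hcos t ht).ne'
  have hcψ' : ContinuousOn ψ' (Icc 0 (Real.pi / 2)) := by
    have h1 := hcpow p
    have h2 := hcpow (p - 1)
    exact (((by fun_prop : Continuous fun t : ℝ => -Real.sin (t / 2) / 2 * p).continuousOn.mul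
      h2).mul hcΦ.continuousOn).add (h1.mul hΦ'.continuousOn)
  obtain ⟨K, hK, hb⟩ := exists_rpow_bounds_sin_half hq hμ0 hcψ hcψ'
  have hW : jacobiWeight p q Φ = fun t => Real.sin (t / 2) ^ q * ψ t := by
    ext t; simp only [jacobiWeight, hψ]; ring
  have hsub : ∀ t ∈ Ioc 0 (Real.pi / 2), t ∈ Icc 0 (Real.pi / 2) := fun t ht => ⟨ht.1.le, ht.2⟩
  have hdV : ∀ t ∈ Ioc 0 (Real.pi / 2), HasDerivAt (fun t => Real.sin (t / 2) ^ q * ψ t)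
      (q * Real.sin (t / 2) ^ (q - 1) * (Real.cos (t / 2) / 2) * ψ t +
        Real.sin (t / 2) ^ q * ψ' t) t := fun t ht => by
    refine (((hasDerivAt_sin_half t).rpow_const (p := q)
      (Or.inl (sin_half_mem ht).2.ne')).mul (hdψ t (hsub t ht))).congr_deriv ?_
    ring
  have hcV : ContinuousOn (fun t => Real.sin (t / 2) ^ q * ψ t) (Ioc 0 (Real.pi / 2)) :=
    fun t ht => (hdV t ht).continuousAt.continuousWithinAt
  have hspow : ∀ r : ℝ, ContinuousOn (fun t => Real.sin (t / 2) ^ r) (Ioc 0 (Real.pi / 2)) :=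
    fun r => ContinuousOn.rpow_const (by fun_prop) fun t ht => Or.inl (sin_half_mem ht).2.ne'
  have hcV' : ContinuousOn (fun t => q * Real.sin (t / 2) ^ (q - 1) * (Real.cos (t / 2) / 2) * ψ t +
        Real.sin (t / 2) ^ q * ψ' t) (Ioc 0 (Real.pi / 2)) :=
    (((continuousOn_const.mul (hspow _)).mul (by fun_prop)).mul (hcψ.mono hsub)).add
      ((hspow _).mul (hcψ'.mono hsub))
  rw [hW]
  refine ⟨intervalIntegrable_of_abs_le_rpow hL hμ hcV fun t ht => (hb t ht).1,
    K * (1 / (1 + μ) + (2 + 1 / -μ) / (Real.pi / 2)) * (Real.pi / 2) ^ (1 + μ), fun n hn d => ?_⟩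
  exact abs_integral_mul_cos_le_of_singularity hL hK hμ hμ0 hdV hcV' (fun t ht => (hb t ht).1)
    (fun t ht => (hb t ht).2) hn d

/-- Decay of the cosine coefficients of a weight with integrable algebraic singularities. -/
theorem jacobiWeight_decay {p q μ : ℝ} {Φ : ℝ → ℝ} (hΦ : ContDiff ℝ 1 Φ) (hμ : -1 < μ)
    (hμ0 : μ < 0) (hp : μ ≤ p) (hq : μ ≤ q) :
    IntervalIntegrable (jacobiWeight p q Φ) volume 0 Real.pi ∧
    ∃ C, ∀ n : ℕ, 0 < n → ∀ d : ℝ,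
      |∫ t in (0 : ℝ)..Real.pi, jacobiWeight p q Φ t * Real.cos (n * t + d)| ≤
        C * (n : ℝ) ^ (-1 - μ) := by
  obtain ⟨i1, C1, h1⟩ := jacobiWeight_half_decay (p := p) hΦ hμ hμ0 hq
  have hΦr : ContDiff ℝ 1 fun t => Φ (Real.pi - t) := hΦ.comp (by fun_prop)
  obtain ⟨i2, C2, h2⟩ := jacobiWeight_half_decay (p := q) hΦr hμ hμ0 hp
  have i2' : IntervalIntegrable (jacobiWeight p q Φ) volume (Real.pi / 2) Real.pi := by
    have := i2.comp_sub_left Real.pi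
    simp only [← jacobiWeight_pi_sub, sub_sub_cancel, sub_zero] at this
    rw [show Real.pi - Real.pi / 2 = Real.pi / 2 by ring] at this
    exact this.symm
  refine ⟨i1.trans i2', C1 + C2, fun n hn d => ?_⟩
  have hc : Continuous fun t : ℝ => Real.cos (n * t + d) := by fun_prop
  rw [← integral_add_adjacent_intervals (i1.mul_continuousOn hc.continuousOn)
    (i2'.mul_continuousOn hc.continuousOn), add_mul]
  refine (abs_add_le _ _).trans (add_le_add (h1 n hn d) ?_)
  have e : ∫ t in (Real.pi / 2)..Real.pi, jacobiWeight p q Φ t * Real.cos (n * t + d) =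
      ∫ t in (0 : ℝ)..Real.pi / 2, jacobiWeight q p (fun t => Φ (Real.pi - t)) t *
        Real.cos (n * t + -(n * Real.pi + d)) := by
    have := integral_comp_sub_left (a := 0) (b := Real.pi / 2)
      (fun t => jacobiWeight p q Φ t * Real.cos (n * t + d)) Real.pi
    rw [sub_zero, show Real.pi - Real.pi / 2 = Real.pi / 2 by ring] at this
    rw [← this]
    congr 1
    ext t
    rw [jacobiWeight_pi_sub, ← Real.cos_neg (n * t + _)]
    congr 2
    ring
  rw [e]
  exact h2 n hn _

lemma hasDerivAt_jacobiWeight {p q : ℝ} {Φ : ℝ → ℝ} (hΦ : ContDiff ℝ 1 Φ) {t : ℝ}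
    (ht : t ∈ Ioo 0 Real.pi) :
    HasDerivAt (jacobiWeight p q Φ)
      (-(1 / 2) * (p * jacobiWeight (p - 1) (q + 1) Φ t) +
        1 / 2 * (q * jacobiWeight (p + 1) (q - 1) Φ t) + jacobiWeight p q (deriv Φ) t) t := by
  have hc := cos_half_pos (by linarith [ht.1, Real.pi_pos]) ht.2
  have hs := sin_half_pos ht.1 (by linarith [ht.2, Real.pi_pos])
  have := (((hasDerivAt_cos_half t).rpow_const (p := p) (Or.inl hc.ne')).mul
    ((hasDerivAt_sin_half t).rpow_const (p := q) (Or.inl hs.ne'))).mul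
    (hΦ.differentiable one_ne_zero t).hasDerivAt
  refine this.congr_deriv ?_
  simp only [jacobiWeight, Real.rpow_add hs, Real.rpow_add hc, Real.rpow_one, Pi.mul_apply]
  ring

/-- Differentiating a power brings down its exponent as the factor a. If that exponent is 0 the
singular term is absent, so no condition is needed then. -/
lemma const_mul_jacobiWeight_decay {a p q μ : ℝ} {Φ : ℝ → ℝ} (hΦ : ContDiff ℝ 1 Φ) (hμ : -1 < μ)
    (hμ0 : μ < 0) (h : a ≠ 0 → μ ≤ p ∧ μ ≤ q) :
    IntervalIntegrable (fun t => a * jacobiWeight p q Φ t) volume 0 Real.pi ∧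
    ∃ C, ∀ n : ℕ, 0 < n → ∀ d : ℝ,
      |∫ t in (0 : ℝ)..Real.pi, a * jacobiWeight p q Φ t * Real.cos (n * t + d)| ≤
        C * (n : ℝ) ^ (-1 - μ) := by
  by_cases ha : a = 0
  · subst ha
    simp only [zero_mul]
    exact ⟨by simp, 0, by simp⟩
  · obtain ⟨i, C, hC⟩ := jacobiWeight_decay hΦ hμ hμ0 (h ha).1 (h ha).2
    refine ⟨i.const_mul a, |a| * C, fun n hn d => ?_⟩
    simp only [mul_assoc, intervalIntegral.integral_const_mul, abs_mul]
    exact mul_le_mul_of_nonneg_left (hC n hn d) (abs_nonneg a)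

/-- Decay of the cosine coefficients of a bounded weight. -/
theorem jacobiWeight_decay_of_nonneg {p q : ℝ} {Φ : ℝ → ℝ} (hΦ : ContDiff ℝ 2 Φ) (hp : 0 ≤ p)
    (hq : 0 ≤ q) :
    ∃ μ C : ℝ, 0 < μ ∧ ∀ n : ℕ, 0 < n →
      |∫ t in (0 : ℝ)..Real.pi, jacobiWeight p q Φ t * Real.cos (n * t)| ≤
        C * (n : ℝ) ^ (-1 - μ) := by
  have hΦ1 : ContDiff ℝ 1 Φ := hΦ.of_le (by norm_num)
  have hΦ' : ContDiff ℝ 1 (deriv Φ) := by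
    have : ContDiff ℝ (1 + 1) Φ := by simpa [one_add_one_eq_two] using hΦ
    exact (contDiff_succ_iff_deriv.1 this).2.2
  -- This μ is an admissible exponent for the derivative of the weight. After one integration by
  -- parts the decay exponent becomes 1 + μ > 0.
  obtain ⟨μ, hμ, hμ0, hμp, hμq⟩ : ∃ μ : ℝ, -1 < μ ∧ μ < 0 ∧ (p ≠ 0 → μ ≤ p - 1) ∧
      (q ≠ 0 → μ ≤ q - 1) := by
    refine ⟨min (-1 / 2) (min (if p = 0 then 0 else p - 1) (if q = 0 then 0 else q - 1)),
      ?_, ?_, fun h => ?_, fun h => ?_⟩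
    · refine lt_min (by norm_num) (lt_min ?_ ?_)
      · split_ifs with h
        · norm_num
        · linarith [lt_of_le_of_ne hp (Ne.symm h)]
      · split_ifs with h
        · norm_num
        · linarith [lt_of_le_of_ne hq (Ne.symm h)]
    · exact (min_le_left _ _).trans_lt (by norm_num)
    · rw [if_neg h]; exact (min_le_right _ _).trans (min_le_left _ _)
    · rw [if_neg h]; exact (min_le_right _ _).trans (min_le_right _ _)
  obtain ⟨i1, C1, h1⟩ := const_mul_jacobiWeight_decay (a := p) (p := p - 1) (q := q + 1) hΦ1 hμ hμ0
    fun h => ⟨hμp h, by linarith⟩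
  obtain ⟨i2, C2, h2⟩ := const_mul_jacobiWeight_decay (a := q) (p := p + 1) (q := q - 1) hΦ1 hμ hμ0
    fun h => ⟨by linarith, hμq h⟩
  obtain ⟨i3, C3, h3⟩ := jacobiWeight_decay (p := p) (q := q) hΦ' hμ hμ0 (by linarith)
    (by linarith)
  refine ⟨1 + μ, 1 / 2 * C1 + 1 / 2 * C2 + C3, by linarith, fun n hn => ?_⟩
  have hn0 : (0 : ℝ) < n := by exact_mod_cast hn
  have hv : ∀ x : ℝ, HasDerivAt (fun t : ℝ => Real.sin (n * t) / n) (Real.cos (n * x)) x := by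
    intro x
    have := (((hasDerivAt_id x).const_mul (n : ℝ)).sin).div_const (n : ℝ)
    refine this.congr_deriv ?_
    simp [hn0.ne']
  have hcW : Continuous (jacobiWeight p q Φ) := by
    have hcΦ := hΦ.continuous
    refine Continuous.mul (Continuous.mul ?_ ?_) hcΦ
    · exact Continuous.rpow_const (by fun_prop) fun _ => Or.inr hp
    · exact Continuous.rpow_const (by fun_prop) fun _ => Or.inr hq
  have hW'i := ((i1.const_mul (-(1 / 2))).add (i2.const_mul (1 / 2))).add i3
  have hibp := integral_mul_deriv_eq_deriv_mul_of_hasDerivAt (a := 0) (b := Real.pi)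
    hcW.continuousOn (fun t _ => (hv t).continuousAt.continuousWithinAt)
    (fun t ht => by
      rw [min_eq_left Real.pi_pos.le, max_eq_right Real.pi_pos.le] at ht
      exact hasDerivAt_jacobiWeight hΦ1 ht)
    (fun t _ => hv t) hW'i ((by fun_prop : Continuous fun t : ℝ =>
      Real.cos (n * t)).intervalIntegrable _ _)
  rw [hibp]
  have hd : ∀ t : ℝ, Real.sin (n * t) / n = Real.cos (n * t + -(Real.pi / 2)) * (1 / n) := fun t => by
    rw [← sub_eq_add_neg, Real.cos_sub_pi_div_two]; ring
  have hcc : Continuous fun t : ℝ => Real.cos (n * t + -(Real.pi / 2)) := by fun_prop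
  have e : ∫ t in (0 : ℝ)..Real.pi, (-(1 / 2) * (p * jacobiWeight (p - 1) (q + 1) Φ t) +
        1 / 2 * (q * jacobiWeight (p + 1) (q - 1) Φ t) + jacobiWeight p q (deriv Φ) t) *
          (Real.sin (n * t) / n) =
      (-(1 / 2) * (∫ t in (0 : ℝ)..Real.pi, p * jacobiWeight (p - 1) (q + 1) Φ t *
          Real.cos (n * t + -(Real.pi / 2))) +
        1 / 2 * (∫ t in (0 : ℝ)..Real.pi, q * jacobiWeight (p + 1) (q - 1) Φ t *
          Real.cos (n * t + -(Real.pi / 2))) +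
        ∫ t in (0 : ℝ)..Real.pi, jacobiWeight p q (deriv Φ) t *
          Real.cos (n * t + -(Real.pi / 2))) * (1 / n) := by
    have j1 := i1.mul_continuousOn hcc.continuousOn
    have j2 := i2.mul_continuousOn hcc.continuousOn
    have j3 := i3.mul_continuousOn hcc.continuousOn
    rw [← intervalIntegral.integral_const_mul, ← intervalIntegral.integral_const_mul,
      ← integral_add (j1.const_mul _) (j2.const_mul _),
      ← integral_add ((j1.const_mul _).add (j2.const_mul _)) j3,
      ← intervalIntegral.integral_mul_const]
    congr 1
    ext t
    rw [hd]
    ring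
  rw [e]
  simp only [Real.sin_nat_mul_pi, mul_zero, Real.sin_zero, zero_div, sub_self, zero_sub, abs_neg]
  rw [abs_mul, abs_of_pos (one_div_pos.2 hn0)]
  have hpow : (n : ℝ) ^ (-1 - (1 + μ)) = (n : ℝ) ^ (-1 - μ) * (1 / n) := by
    rw [show -1 - (1 + μ) = (-1 - μ) + -1 by ring, Real.rpow_add hn0, Real.rpow_neg_one, one_div]
  rw [hpow, ← mul_assoc]
  gcongr
  have a1 := abs_le.1 (h1 n hn (-(Real.pi / 2)))
  have a2 := abs_le.1 (h2 n hn (-(Real.pi / 2)))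
  have a3 := abs_le.1 (h3 n hn (-(Real.pi / 2)))
  rw [abs_le]
  constructor <;> nlinarith [a1.1, a1.2, a2.1, a2.2, a3.1, a3.2]

/-! ### The Bessel factor and the change of variable. -/

/-- The coefficients of the entire function `y ↦ (√y)^(-ν) J_ν(2√y)`. -/
noncomputable def besselCoeff (ν : ℝ) (m : ℕ) : ℝ :=
  (-1 : ℝ) ^ m / ((m.factorial : ℝ) * Real.Gamma ((m : ℝ) + ν + 1))

/-- The entire function with coefficients `besselCoeff ν`. -/
noncomputable def besselEntire (ν : ℝ) : ℝ → ℝ :=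
  FormalMultilinearSeries.ofScalarsSum (besselCoeff ν)

/-- The ratio of consecutive coefficients tends to 0, so the radius of convergence is infinite. -/
lemma contDiff_besselEntire {ν : ℝ} (hν : 0 ≤ ν) : ContDiff ℝ 2 (besselEntire ν) := by
  have hG : ∀ m : ℕ, 0 < Real.Gamma ((m : ℝ) + ν + 1) := fun m => Real.Gamma_pos_of_pos (by positivity)
  have hne : ∀ m, besselCoeff ν m ≠ 0 := fun m =>
    div_ne_zero (pow_ne_zero _ (by norm_num)) (mul_ne_zero (by positivity) (hG m).ne')
  have hnorm : ∀ m, ‖besselCoeff ν m‖ = 1 / ((m.factorial : ℝ) * Real.Gamma ((m : ℝ) + ν + 1)) :=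
    fun m => by
      have := hG m
      rw [besselCoeff, norm_div, norm_pow, norm_neg, norm_one, one_pow, Real.norm_of_nonneg]
      positivity
  have hratio : ∀ m : ℕ, ‖besselCoeff ν m.succ‖ / ‖besselCoeff ν m‖ =
      1 / ((m : ℝ) + 1) * (1 / ((m : ℝ) + ν + 1)) := fun m => by
    have h1 := hG m
    have h2 : (m : ℝ) + ν + 1 ≠ 0 := by positivity
    rw [hnorm, hnorm, Nat.factorial_succ, show ((m.succ : ℕ) : ℝ) + ν + 1 = (m + ν + 1) + 1 by
      push_cast; ring, Real.Gamma_add_one h2]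
    push_cast
    field_simp
  have hrad : (FormalMultilinearSeries.ofScalars ℝ (besselCoeff ν)).radius = ⊤ := by
    refine FormalMultilinearSeries.ofScalars_radius_eq_top_of_tendsto ℝ _
      (Filter.Eventually.of_forall hne) ?_
    simp only [hratio]
    refine squeeze_zero (fun m => by positivity) (fun m => ?_)
      (tendsto_one_div_add_atTop_nhds_zero_nat (𝕜 := ℝ))
    refine mul_le_of_le_one_right (by positivity) ?_
    rw [div_le_one (by positivity)]
    have : (0 : ℝ) ≤ m := by positivity
    linarith
  have hfp := (FormalMultilinearSeries.ofScalars ℝ (besselCoeff ν)).hasFPowerSeriesOnBall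
    (by rw [hrad]; exact ENNReal.zero_lt_top)
  have han : AnalyticOnNhd ℝ (besselEntire ν) univ := by
    have := hfp.analyticOnNhd
    rw [hrad, Metric.eball_top] at this
    exact this
  exact han.contDiff

lemma besselJ_eq {ν x : ℝ} (hν : 0 ≤ ν) (hx : 0 ≤ x) :
    besselJ ν x = (x / 2) ^ ν * besselEntire ν ((x / 2) ^ 2) := by
  rw [besselJ, besselEntire, FormalMultilinearSeries.ofScalarsSum_eq_tsum, ← tsum_mul_left]
  refine tsum_congr fun m => ?_
  have hx2 : 0 ≤ x / 2 := by positivity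
  rw [Real.rpow_add_of_nonneg hx2 (by positivity) hν,
    show (2 * (m : ℝ)) = ((2 * m : ℕ) : ℝ) by push_cast; ring, Real.rpow_natCast, smul_eq_mul,
    ← pow_mul, besselCoeff]
  ring

/-- The smooth factor of the Bessel function in the variable `t`. -/
noncomputable def besselFactor (ν ω t : ℝ) : ℝ :=
  (ω / 2) ^ ν * besselEntire ν ((ω * Real.cos (t / 2) ^ 2 / 2) ^ 2)

lemma contDiff_besselFactor {ν : ℝ} (hν : 0 ≤ ν) (ω : ℝ) : ContDiff ℝ 2 (besselFactor ν ω) := by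
  have := contDiff_besselEntire hν
  refine contDiff_const.mul (this.comp ?_)
  fun_prop

lemma half_cos_eq (t : ℝ) : 1 / 2 + 1 / 2 * Real.cos t = Real.cos (t / 2) ^ 2 := by
  have := Real.cos_sq (t / 2)
  rw [show 2 * (t / 2) = t by ring] at this
  rw [this]; ring

/-- Here x = cos²(t/2) and 1 - x = sin²(t/2), which doubles the exponents. The Jacobian sin(t/2)
cos(t/2) adds 1 to each, and the factor x^ν split off from the Bessel function adds 2ν. -/
theorem besselTransform_eq {α β ν ω : ℝ} (hν : 0 ≤ ν) (hω : 0 ≤ ω) (g : ℝ → ℝ) :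
    besselTransform α β ν ω g = ∫ t in (0 : ℝ)..Real.pi,
      jacobiWeight (2 * (α + ν) + 1) (2 * β + 1) (besselFactor ν ω) t *
        g (1 / 2 + 1 / 2 * Real.cos t) := by
  have h := integral_half_cos (fun x => x ^ α * (1 - x) ^ β * g x * besselJ ν (ω * x))
    (right_mem_Icc.2 Real.pi_pos.le)
  rw [Real.cos_pi, show (1 / 2 + 1 / 2 * -1 : ℝ) = 0 by norm_num, integral_symm] at h
  rw [besselTransform, ← neg_inj, h, ← intervalIntegral.integral_neg]
  -- The power laws need cos(t/2) > 0, which fails at t = π.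
  have hne : ∀ᵐ t : ℝ, t ≠ Real.pi := by simp [ae_iff, measure_singleton]
  refine integral_congr_ae ?_
  filter_upwards [hne] with t ht1 ht
  rw [uIoc_of_le Real.pi_pos.le] at ht
  have htpi : t < Real.pi := lt_of_le_of_ne ht.2 ht1
  have hc := cos_half_pos (by linarith [ht.1, Real.pi_pos]) htpi
  have hs := sin_half_pos ht.1 (by linarith [Real.pi_pos])
  have hsq : 1 - Real.cos (t / 2) ^ 2 = Real.sin (t / 2) ^ 2 := by
    rw [← Real.sin_sq_add_cos_sq (t / 2)]; ring
  have hsin : Real.sin t = 2 * Real.sin (t / 2) * Real.cos (t / 2) := by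
    rw [← Real.sin_two_mul]; congr 1; ring
  have hpow : ∀ {y : ℝ} (r : ℝ), 0 < y → (y ^ 2) ^ r = y ^ (2 * r) := fun r hy => by
    rw [Real.rpow_mul hy.le]; norm_cast
  rw [besselJ_eq hν (by have := (half_cos_mem t).1; positivity), half_cos_eq, hsq, hsin,
    hpow _ hc, hpow _ hs, show ω * Real.cos (t / 2) ^ 2 / 2 = ω / 2 * Real.cos (t / 2) ^ 2 by ring,
    Real.mul_rpow (by positivity) (by positivity), hpow _ hc, jacobiWeight, besselFactor,
    show 2 * (α + ν) + 1 = 2 * α + 2 * ν + 1 by ring, Real.rpow_add hc, Real.rpow_add hc,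
    Real.rpow_add hs, Real.rpow_one, Real.rpow_one,
    show ω * Real.cos (t / 2) ^ 2 / 2 = ω / 2 * Real.cos (t / 2) ^ 2 by ring]
  ring

/-! ### The quadrature error as a series and its summation. -/

/-- The cosine coefficients of a weight. -/
noncomputable def weightCoeff (W : ℝ → ℝ) (n : ℤ) : ℝ :=
  ∫ t in (0 : ℝ)..Real.pi, W t * Real.cos (n * t)

lemma weightCoeff_neg (W : ℝ → ℝ) (n : ℤ) : weightCoeff W (-n) = weightCoeff W n := by
  simp [weightCoeff]

/-- Series representation of the error of a product rule based on Clenshaw-Curtis interpolation. -/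
theorem hasSum_interpolation_error {f W : ℝ → ℝ} (hf : ContinuousOn f (Icc 0 1))
    (hs : CoeffDecay f 2) (hW : IntervalIntegrable W volume 0 Real.pi)
    {N : ℕ} (hN : 0 < N) {ρ : ℤ → ℤ} (hρ : ∀ n, (ρ n).natAbs ≤ N)
    (hρn : ∀ n, (2 * N : ℤ) ∣ n - ρ n) :
    HasSum (fun n : ℤ => cosCoeff f n / Real.pi * (weightCoeff W n - weightCoeff W (ρ n)))
      ((∫ t in (0 : ℝ)..Real.pi, W t * f (1 / 2 + 1 / 2 * Real.cos t)) -
        ∫ t in (0 : ℝ)..Real.pi, W t * (interpolant N f).eval (1 / 2 + 1 / 2 * Real.cos t)) := by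
  have hcos : ∀ m : ℤ, Continuous fun t : ℝ => Real.cos (m * t) := fun m => by fun_prop
  have hWi : ∀ m : ℤ, IntervalIntegrable (fun t => W t * Real.cos (m * t)) volume 0 Real.pi :=
    fun m => hW.mul_continuousOn (hcos m).continuousOn
  have hsum := hs.summable
  -- Termwise integration by dominated convergence, with majorant |W| ∑ |a_n| / π.
  have main : ∀ {σ : ℤ → ℤ} {g : ℝ → ℝ}, (∀ t, HasSum (fun n : ℤ =>
      cosCoeff f n / Real.pi * Real.cos (σ n * t)) (g t)) →
      HasSum (fun n : ℤ => cosCoeff f n / Real.pi * weightCoeff W (σ n))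
        (∫ t in (0 : ℝ)..Real.pi, W t * g t) := by
    intro σ g hg
    have := intervalIntegral.hasSum_integral_of_dominated_convergence (μ := volume)
      (a := 0) (b := Real.pi)
      (F := fun (n : ℤ) t => cosCoeff f n / Real.pi * (W t * Real.cos (σ n * t)))
      (f := fun t => W t * g t)
      (fun (n : ℤ) t => |cosCoeff f n| / Real.pi * |W t|)
      (fun n => (intervalIntegrable_iff.1 ((hWi (σ n)).const_mul _)).aestronglyMeasurable)
      (fun n => ae_of_all _ fun t _ => by
        rw [norm_mul, norm_mul, norm_div, Real.norm_of_nonneg Real.pi_pos.le]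
        refine mul_le_mul_of_nonneg_left ?_ (by positivity)
        exact mul_le_of_le_one_right (norm_nonneg _) (Real.abs_cos_le_one _))
      (ae_of_all _ fun t _ => (hsum.div_const _).mul_right _)
      (by
        simp only [tsum_mul_right]
        exact hW.abs.const_mul _)
      (ae_of_all _ fun t _ => by
        have h := (hg t).mul_left (W t)
        simp only [mul_left_comm (W t)] at h
        exact h)
    simpa only [intervalIntegral.integral_const_mul, weightCoeff] using this
  have h1 := main (σ := fun n => n) (hasSum_cosCoeff hf hs)
  have h2 := main (σ := ρ) (hasSum_interpolant hf hs hN hρ hρn)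
  simpa only [mul_sub] using h1.sub h2

/-- `n = 2 N l + (r - N)` with `0 ≤ r < 2 N`. -/
noncomputable def aliasEquiv (N : ℕ) [NeZero (2 * N)] : ℤ ≃ ℤ × Fin (2 * N) :=
  (Equiv.addRight (N : ℤ)).trans (Int.divModEquiv (2 * N))

lemma aliasEquiv_symm (N : ℕ) [NeZero (2 * N)] (l : ℤ) (r : Fin (2 * N)) :
    (aliasEquiv N).symm (l, r) = l * (2 * N) + ((r : ℤ) - N) := by
  simp [aliasEquiv]
  ring

/-- The residues run through -N, …, N - 1, and evenness folds the negative ones onto 1, …, N. -/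
lemma sum_abs_weightCoeff_le {c : ℤ → ℝ} (hc : ∀ n, c (-n) = c n) (N : ℕ) :
    ∑ r : Fin (2 * N), |c ((r : ℤ) - N)| ≤ |c 0| + 2 * ∑ i ∈ Finset.range N, |c (i + 1 : ℕ)| := by
  rw [Fin.sum_univ_eq_sum_range (fun i : ℕ => |c ((i : ℤ) - N)|), two_mul N,
    Finset.sum_range_add]
  have h1 : ∑ i ∈ Finset.range N, |c ((i : ℤ) - N)| = ∑ i ∈ Finset.range N, |c (i + 1 : ℕ)| := by
    rw [← Finset.sum_range_reflect]
    refine Finset.sum_congr rfl fun i hi => ?_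
    have := Finset.mem_range.1 hi
    rw [← hc]
    congr 2
    omega
  have h2 : ∑ i ∈ Finset.range N, |c (((N + i : ℕ) : ℤ) - N)| ≤
      |c 0| + ∑ i ∈ Finset.range N, |c (i + 1 : ℕ)| := by
    have e : ∀ i : ℕ, |c (((N + i : ℕ) : ℤ) - N)| = |c (i : ℕ)| := fun i => by
      congr 2; push_cast; ring
    simp only [e]
    have : ∑ i ∈ Finset.range N, |c (i : ℕ)| ≤ ∑ i ∈ Finset.range (N + 1), |c (i : ℕ)| :=
      Finset.sum_le_sum_of_subset_of_nonneg (Finset.range_mono (Nat.le_succ N))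
        fun _ _ _ => abs_nonneg _
    rw [Finset.sum_range_succ'] at this
    simpa [add_comm] using this
  linarith

/-- Error bound from decay of the coefficients of the function and of the weight. -/
theorem exists_interpolation_error_le {f W : ℝ → ℝ} {k : ℕ} {μ σ D S : ℝ} (hk : 1 ≤ k)
    (hf : ContinuousOn f (Icc 0 1)) (hs : CoeffDecay f (k + 1))
    (hW : IntervalIntegrable W volume 0 Real.pi) (hμ : -1 < μ) (hσ : 0 ≤ σ) (hσμ : -μ ≤ σ)
    (hD : ∀ n : ℕ, 0 < n → |weightCoeff W n| ≤ D * (n : ℝ) ^ (-1 - μ))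
    (hS : ∀ N : ℕ, 0 < N → ∑ i ∈ Finset.range N, ((i + 1 : ℕ) : ℝ) ^ (-1 - μ) ≤ S * (N : ℝ) ^ σ) :
    ∃ C : ℝ, ∀ N : ℕ, 0 < N →
      |(∫ t in (0 : ℝ)..Real.pi, W t * f (1 / 2 + 1 / 2 * Real.cos t)) -
        ∫ t in (0 : ℝ)..Real.pi, W t * (interpolant N f).eval (1 / 2 + 1 / 2 * Real.cos t)| ≤
        C * (N : ℝ) ^ (-(k : ℝ) - 1 + σ) := by
  obtain ⟨A, hA⟩ := id hs
  have hA0 : 0 ≤ A := le_trans (by positivity) (hA 0)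
  have hD0 : 0 ≤ D := by
    have := (abs_nonneg _).trans (hD 1 one_pos)
    simpa using this
  set Z : ℝ := ∑' l : ℤ, 1 / (l : ℝ) ^ 2 with hZ
  have hZs : HasSum (fun l : ℤ => 1 / (l : ℝ) ^ 2) Z :=
    (Real.summable_one_div_int_pow.2 one_lt_two).hasSum
  have hZ0 : 0 ≤ Z := tsum_nonneg fun l => by positivity
  -- Z sums over the blocks l. In a block, 2D bounds the 2N terms w_n, and |w_0| + 2DS bounds the
  -- aliased coefficients.
  refine ⟨A / Real.pi * (Z * (2 * D + |weightCoeff W 0| + 2 * D * S)), fun N hN => ?_⟩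
  have hN0 : (0 : ℝ) < N := by exact_mod_cast hN
  have hN1 : (1 : ℝ) ≤ N := by exact_mod_cast hN
  have : NeZero (2 * N) := ⟨by omega⟩
  set e := aliasEquiv N with he
  have hρ : ∀ n : ℤ, (((e n).2 : ℤ) - N).natAbs ≤ N := fun n => by
    have := (e n).2.2
    omega
  have hsymm : ∀ n : ℤ, n = (e n).1 * (2 * N) + (((e n).2 : ℤ) - N) := fun n => by
    rw [← aliasEquiv_symm, ← he, Prod.mk.eta, Equiv.symm_apply_apply]
  have hρn : ∀ n : ℤ, (2 * N : ℤ) ∣ n - (((e n).2 : ℤ) - N) := fun n =>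
    ⟨(e n).1, by linarith [hsymm n]⟩
  have hsum := hasSum_interpolation_error hf (hs.mono (by omega)) hW hN hρ hρn
  rw [← e.symm.hasSum_iff] at hsum
  have hv : HasSum (fun r : Fin (2 * N) => D * (N : ℝ) ^ (-1 - μ) + |weightCoeff W ((r : ℤ) - N)|)
      (∑ r : Fin (2 * N), (D * (N : ℝ) ^ (-1 - μ) + |weightCoeff W ((r : ℤ) - N)|)) :=
    hasSum_fintype _
  have hprod := (hZs.mul hv (hZs.summable.mul_of_nonneg hv.summable (fun l => by positivity)
    (fun r => by positivity))).mul_left (A / Real.pi * (N : ℝ) ^ (-(k : ℝ) - 1))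
  have hbd : ∀ p : ℤ × Fin (2 * N), ‖((fun n : ℤ => cosCoeff f n / Real.pi *
      (weightCoeff W n - weightCoeff W (((e n).2 : ℤ) - N))) ∘ e.symm) p‖ ≤
      A / Real.pi * (N : ℝ) ^ (-(k : ℝ) - 1) * (1 / (p.1 : ℝ) ^ 2 *
        (D * (N : ℝ) ^ (-1 - μ) + |weightCoeff W ((p.2 : ℤ) - N)|)) := by
    rintro ⟨l, r⟩
    simp only [Function.comp_apply, Equiv.apply_symm_apply]
    set n : ℤ := e.symm (l, r) with hn
    have hnl : n = l * (2 * N) + ((r : ℤ) - N) := aliasEquiv_symm N l r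
    -- For l = 0 aliasing fixes n and the term vanishes; so does the majorant, because 1 / 0 = 0.
    rcases eq_or_ne l 0 with rfl | hl
    · rw [show n = (r : ℤ) - N by rw [hnl]; ring]
      simp
    -- |n| ≥ 2N|l| - N ≥ N|l|, as |l| ≥ 1.
    · have hlb : (N : ℤ) * |l| ≤ |n| := by
        have h1 : |l * (2 * N)| ≤ |n| + |(r : ℤ) - N| := by
          have := abs_sub n ((r : ℤ) - N)
          rwa [hnl, add_sub_cancel_right, ← hnl] at this
        have h2 : |(r : ℤ) - N| ≤ N := by
          have := r.2
          rw [abs_le]; constructor <;> omega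
        rw [abs_mul, abs_of_nonneg (by positivity : (0 : ℤ) ≤ 2 * N)] at h1
        have h3 : (N : ℤ) * 1 ≤ N * |l| := by
          gcongr; exact Int.one_le_abs hl
        nlinarith
      have hlR : (N : ℝ) * |(l : ℝ)| ≤ |(n : ℝ)| := by exact_mod_cast hlb
      have hl1 : (1 : ℝ) ≤ |(l : ℝ)| := by exact_mod_cast Int.one_le_abs hl
      have hnN : (N : ℝ) ≤ |(n : ℝ)| := le_trans (le_mul_of_one_le_right hN0.le hl1) hlR
      have hnA : |cosCoeff f n| ≤ A * (N : ℝ) ^ (-(k : ℝ) - 1) * (1 / (l : ℝ) ^ 2) := by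
        have h1 : (N : ℝ) ^ (k + 1) * (l : ℝ) ^ 2 ≤ (1 + |(n : ℝ)|) ^ (k + 1) := by
          calc (N : ℝ) ^ (k + 1) * (l : ℝ) ^ 2 = (N : ℝ) ^ (k + 1) * |(l : ℝ)| ^ 2 := by
                rw [sq_abs]
            _ ≤ (N : ℝ) ^ (k + 1) * |(l : ℝ)| ^ (k + 1) := by
                gcongr
                omega
            _ = ((N : ℝ) * |(l : ℝ)|) ^ (k + 1) := (mul_pow _ _ _).symm
            _ ≤ _ := by gcongr; linarith
        have h2 : |cosCoeff f n| * ((N : ℝ) ^ (k + 1) * (l : ℝ) ^ 2) ≤ A :=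
          (mul_le_mul_of_nonneg_left h1 (abs_nonneg _)).trans (hA n)
        have hl2 : 0 < (l : ℝ) ^ 2 := by positivity
        rw [← le_div_iff₀ (by positivity)] at h2
        refine h2.trans_eq ?_
        rw [show -(k : ℝ) - 1 = -((k + 1 : ℕ) : ℝ) by push_cast; ring, Real.rpow_neg hN0.le,
          Real.rpow_natCast]
        field_simp
      have hnW : |weightCoeff W n| ≤ D * (N : ℝ) ^ (-1 - μ) := by
        have h1 : |weightCoeff W n| = |weightCoeff W (n.natAbs : ℤ)| := by
          rcases n.natAbs_eq with h | h
          · rw [← h]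
          · conv_lhs => rw [h, weightCoeff_neg]
        have h2 : ((n.natAbs : ℕ) : ℝ) = |(n : ℝ)| := by
          rw [Nat.cast_natAbs]; push_cast; rfl
        have h3 : 0 < n.natAbs := by
          have : (0 : ℝ) < n.natAbs := by rw [h2]; linarith
          exact_mod_cast this
        rw [h1]
        refine (hD _ h3).trans ?_
        rw [h2]
        exact mul_le_mul_of_nonneg_left
          (Real.rpow_le_rpow_of_nonpos hN0 hnN (by linarith)) hD0
      rw [norm_mul, norm_div, Real.norm_of_nonneg Real.pi_pos.le, Real.norm_eq_abs,
        Real.norm_eq_abs]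
      calc |cosCoeff f n| / Real.pi * |weightCoeff W n - weightCoeff W ((r : ℤ) - N)|
          ≤ A * (N : ℝ) ^ (-(k : ℝ) - 1) * (1 / (l : ℝ) ^ 2) / Real.pi *
            (D * (N : ℝ) ^ (-1 - μ) + |weightCoeff W ((r : ℤ) - N)|) := by
            gcongr
            exact (abs_sub _ _).trans (add_le_add hnW le_rfl)
        _ = _ := by ring
  have hfin := tsum_of_norm_bounded hprod hbd
  rw [hsum.tsum_eq, Real.norm_eq_abs] at hfin
  refine hfin.trans ?_
  have hsumW : ∑ r : Fin (2 * N), (D * (N : ℝ) ^ (-1 - μ) + |weightCoeff W ((r : ℤ) - N)|) ≤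
      (2 * D + |weightCoeff W 0| + 2 * D * S) * (N : ℝ) ^ σ := by
    rw [Finset.sum_add_distrib, Finset.sum_const, Finset.card_univ, Fintype.card_fin, nsmul_eq_mul]
    have h1 := sum_abs_weightCoeff_le (weightCoeff_neg W) N
    have h2 : ∑ i ∈ Finset.range N, |weightCoeff W (i + 1 : ℕ)| ≤ D * (S * (N : ℝ) ^ σ) := by
      refine le_trans (Finset.sum_le_sum fun i _ => hD (i + 1) i.succ_pos) ?_
      rw [← Finset.mul_sum]
      exact mul_le_mul_of_nonneg_left (hS N hN) hD0
    have h3 : ((2 * N : ℕ) : ℝ) * (D * (N : ℝ) ^ (-1 - μ)) ≤ 2 * D * (N : ℝ) ^ σ := by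
      have : (N : ℝ) * (N : ℝ) ^ (-1 - μ) = (N : ℝ) ^ (-μ) := by
        rw [show -μ = 1 + (-1 - μ) by ring, Real.rpow_add hN0, Real.rpow_one]
      calc ((2 * N : ℕ) : ℝ) * (D * (N : ℝ) ^ (-1 - μ))
          = 2 * D * ((N : ℝ) * (N : ℝ) ^ (-1 - μ)) := by push_cast; ring
        _ ≤ _ := by
          rw [this]
          gcongr
    have h4 : |weightCoeff W 0| ≤ |weightCoeff W 0| * (N : ℝ) ^ σ :=
      le_mul_of_one_le_right (abs_nonneg _) (Real.one_le_rpow hN1 hσ)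
    linarith
  calc _ ≤ A / Real.pi * (N : ℝ) ^ (-(k : ℝ) - 1) *
        (Z * ((2 * D + |weightCoeff W 0| + 2 * D * S) * (N : ℝ) ^ σ)) := by gcongr
    _ = _ := by rw [Real.rpow_add hN0]; ring

/-- The inductive step is Bernoulli's inequality for the concave power -μ in (0, 1), applied to
N/(N+1). -/
lemma sum_rpow_le {μ : ℝ} (hμ : -1 < μ) (hμ0 : μ < 0) (N : ℕ) :
    ∑ i ∈ Finset.range N, ((i + 1 : ℕ) : ℝ) ^ (-1 - μ) ≤ 1 / -μ * (N : ℝ) ^ (-μ) := by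
  have hs : 0 < -μ := by linarith
  have hne : μ ≠ 0 := hμ0.ne
  induction N with
  | zero => simp [Real.zero_rpow hs.ne']
  | succ N ih =>
    rw [Finset.sum_range_succ]
    set x : ℝ := ((N + 1 : ℕ) : ℝ) with hx
    have hx0 : 0 < x := by positivity
    have hxN : (N : ℝ) = x * (1 + -(1 / x)) := by
      rw [hx]; push_cast; field_simp; ring
    have hx1 : 1 / x ≤ 1 := by
      rw [div_le_one hx0, hx]; push_cast; linarith [(Nat.cast_nonneg N : (0 : ℝ) ≤ N)]
    have hB := rpow_one_add_le_one_add_mul_self (s := -(1 / x)) (by linarith) hs.le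
      (by linarith : -μ ≤ 1)
    have hpow : x ^ (-1 - μ) = x ^ (-μ) * (1 / x) := by
      rw [show -1 - μ = -μ + -1 by ring, Real.rpow_add hx0, Real.rpow_neg_one, one_div]
    have hp := Real.rpow_pos_of_pos hx0 (-μ)
    have hN : (N : ℝ) ^ (-μ) ≤ x ^ (-μ) * (1 + -μ * -(1 / x)) := by
      rw [hxN, Real.mul_rpow hx0.le (by linarith)]
      gcongr
    calc _ ≤ 1 / -μ * (x ^ (-μ) * (1 + -μ * -(1 / x))) + x ^ (-1 - μ) := by
          refine add_le_add (ih.trans ?_) le_rfl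
          gcongr
      _ = 1 / -μ * x ^ (-μ) := by rw [hpow]; field_simp; ring

lemma exists_sum_rpow_le {μ : ℝ} (hμ : 0 < μ) :
    ∃ S, ∀ N : ℕ, ∑ i ∈ Finset.range N, ((i + 1 : ℕ) : ℝ) ^ (-1 - μ) ≤ S := by
  have h : Summable fun i : ℕ => ((i + 1 : ℕ) : ℝ) ^ (-1 - μ) :=
    (summable_nat_add_iff (f := fun i : ℕ => (i : ℝ) ^ (-1 - μ)) 1).2
      (Real.summable_nat_rpow.2 (by linarith))
  exact ⟨_, fun N => h.sum_le_tsum _ fun i _ => by positivity⟩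

end CCF

/-! ### The two regimes. -/

theorem theorem3p1 (k : ℕ) (hk : 1 ≤ k) (f : ℝ → ℝ) (hf : CCF.HasBVDeriv k f)
    (α β ν ω : ℝ) (hα : -1 < α) (hβ : -1 < β) (hν : 0 ≤ ν) (hω : 0 ≤ ω) :
    (min α β < -1 / 2 →
      ∃ C : ℝ, ∀ N : ℕ, k + 1 ≤ N →
        |CCF.besselTransform α β ν ω f - CCF.filonRule α β ν ω N f|
          ≤ C * (N : ℝ) ^ (-2 * min α β - (k : ℝ) - 2)) ∧
    (-1 / 2 ≤ min α β →
      ∃ C : ℝ, ∀ N : ℕ, k + 1 ≤ N →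
        |CCF.besselTransform α β ν ω f - CCF.filonRule α β ν ω N f|
          ≤ C * (N : ℝ) ^ (-(k : ℝ) - 1)) := by
  have hfc := hf.continuousOn
  have hfd := hf.coeffDecay hk
  have hΦ := CCF.contDiff_besselFactor hν ω
  have hΦ1 : ContDiff ℝ 1 (CCF.besselFactor ν ω) := hΦ.of_le (by norm_num)
  simp only [CCF.filonRule, CCF.besselTransform_eq hν hω]
  have hmα := min_le_left α β
  have hmβ := min_le_right α β
  have hm : -1 < min α β := lt_min hα hβ
  constructor
  · intro h
    obtain ⟨hWi, D, hD⟩ := CCF.jacobiWeight_decay (p := 2 * (α + ν) + 1) (q := 2 * β + 1)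
      (μ := 2 * min α β + 1) hΦ1 (by linarith) (by linarith) (by linarith) (by linarith)
    -- With σ = -μ, the exponent -k - 1 + σ is -2 min(α,β) - k - 2.
    obtain ⟨C, hC⟩ := CCF.exists_interpolation_error_le (σ := -(2 * min α β + 1)) hk hfc hfd hWi
      (by linarith) (by linarith) le_rfl
      (fun n hn => by simpa [CCF.weightCoeff] using hD n hn 0)
      (fun N _ => CCF.sum_rpow_le (by linarith) (by linarith) N)
    refine ⟨C, fun N hN => (hC N (by omega)).trans_eq ?_⟩
    congr 2
    ring
  · intro h
    -- Only integrability of the weight is taken from here, so any value in (-1, 0) would serve as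
    -- μ.
    obtain ⟨hWi, -⟩ := CCF.jacobiWeight_decay (p := 2 * (α + ν) + 1) (q := 2 * β + 1)
      (μ := -1 / 2) hΦ1 (by norm_num) (by norm_num) (by linarith) (by linarith)
    obtain ⟨μ, D, hμ, hD⟩ := CCF.jacobiWeight_decay_of_nonneg (p := 2 * (α + ν) + 1)
      (q := 2 * β + 1) hΦ (by linarith) (by linarith)
    obtain ⟨S, hS⟩ := CCF.exists_sum_rpow_le hμ
    obtain ⟨C, hC⟩ := CCF.exists_interpolation_error_le (σ := 0) (S := S) hk hfc hfd hWi
      (by linarith) le_rfl (by linarith)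
      (fun n hn => by simpa [CCF.weightCoeff] using hD n hn)
      (fun N _ => by simpa using hS N)
    refine ⟨C, fun N hN => (hC N (by omega)).trans_eq ?_⟩
    rw [add_zero]
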